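/- Let $\alpha,\mu>0$ and $\beta,\gamma,\delta\ge 0$. Let $f:\mathbb R\to\mathbb R$ be of class $C^1$ and such that, for some $m>1$ and $C>0$, $$|f(x)|\le C|x|^m,\qquad |f'(x)|\le C|x|^{m-1},\qquad f(0)=f'(0)=0,\qquad \int_0^x f(\xi)\,d\xi\le 0\qquad\text{for all }x\in\mathbb R.$$ Let $h:\mathbb R\to L^2(0,\pi)$ be continuously differentiable and periodic with some period $\tau>0$ (so that $\|h(t)\|_{L^2}$ and $\|h_t(t)\|_{L^2}$ are bounded), and let $\varepsilon\in\mathbb R$. Consider the forced Rayleigh beam equation with hinged ends on $(0,\pi)$, $$u_{tt}-\mu u_{ttxx}=-\alpha u_{xxxx}+\beta u_{txx}-\gamma u-\delta u_t+f(u)+\varepsilon h(t,x),\qquad u=u_{xx}=0\ \text{ at } x=0,\pi,$$ as an evolution equation for $U=(u,v)$, $v=u_t$, in $\mathcal H=H^1_0(0,\pi)\times L^2(0,\pi)$. With $\mathcal M=1-\mu\partial_x^2$ (Dirichlet conditions) it reads $$U_t=AU+\bigl(0,\mathcal M^{-1}(f(u)+\varepsilon h)\bigr),\qquad A(u,v)=\bigl(v,\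 \mathcal M^{-1}(-(\alpha\partial_x^4+\gamma)u+(\beta\partial_x^2-\delta)v)\bigr),$$ where $D(A)=(H^2(0,\pi)\cap H^1_0(0,\pi))\times H^1_0(0,\pi)$. A classical solution on a time interval $J$ is a map $U\in C^1(J,\mathcal H)$ with values in $D(A)$ that satisfies the equation at every $t\in J$ (the terms $u_{xxxx}$ and $u_{ttxx}$ being understood by transposition, that is, after integration against smooth functions of $x$ vanishing at $0$ and $\pi$). A mild solution on an interval $J$ starting at $0$ is a map $U\in C(J,\mathcal H)$ with $U(t)=e^{tA}U(0)+\int_0^te^{(t-s)A}\bigl(0,\mathcal M^{-1}(f(u(s))+\varepsilon h(s))\bigr)ds$. Then every solution exists for all times: for every $U_0=(u_0,v_0)\in D(A)$ there is a classical solution $U$ on $[0,\infty)$ with $U(0)=U_0$; it is also a mild solution, and for every $T$ every classical or mild solution on $[0,T)$ with initial value $U_0$ coincides with $U$ on $[0,T)$. -/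

import Mathlib

namespace RayleighBeam

noncomputable section

open scoped ContDiff

/-- The real Hilbert space `L²(0, π)`. -/
abbrev L2 : Type :=
  MeasureTheory.Lp ℝ 2 (MeasureTheory.volume.restrict (Set.Ioo (0 : ℝ) Real.pi))

/-- The pairing `∫₀^π w(x) φ(x) dx`. -/
def pair (w φ : ℝ → ℝ) : ℝ :=
  ∫ x in Set.Ioo (0 : ℝ) Real.pi, w x * φ x

/-- `w ∈ H¹(0, π)` with weak derivative `w'`: integration by parts holds without boundary terms
against every smooth `φ` with `φ(0) = φ(π) = 0`. (Since `C_c^∞(0, π)` is dense in the space of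
such `φ` for the `H¹` norm, this is the usual weak derivative.) -/
def IsWeakDeriv (w w' : L2) : Prop :=
  ∀ φ : ℝ → ℝ, ContDiff ℝ ∞ φ → φ 0 = 0 → φ Real.pi = 0 →
    pair w (deriv φ) = - pair w' φ

/-- `w ∈ H¹₀(0, π)` with weak derivative `w'`: integration by parts holds without boundary terms
against every smooth `φ`, whatever its values at `0` and `π`. (Equivalently: `w` has the weak
derivative `w'` and its continuous representative vanishes at `0` and at `π`.) -/
def IsWeakDerivZero (w w' : L2) : Prop :=
  ∀ φ : ℝ → ℝ, ContDiff ℝ ∞ φ → pair w (deriv φ) = - pair w' φ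

/-- The coefficients of the beam equation
`u_tt - μ u_ttxx = -α u_xxxx + β u_txx - γ u - δ u_t + f(u) + ε h`. -/
structure BeamParams where
  /-- bending stiffness -/
  α : ℝ
  /-- internal damping -/
  β : ℝ
  /-- linear stiffness of the foundation -/
  γ : ℝ
  /-- external damping -/
  δ : ℝ
  /-- rotary inertia -/
  μ : ℝ

/-- The assumptions on the nonlinear force `f` of the foundation: `f` is `C¹`, with
`|f(x)| ≤ C|x|^m` and `|f'(x)| ≤ C|x|^(m-1)` for some `m > 1`, `f(0) = f'(0) = 0`, and its
primitive vanishing at `0` is nonpositive. -/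
structure FoundationAssumption (f : ℝ → ℝ) : Prop where
  contDiff : ContDiff ℝ 1 f
  growth : ∃ m : ℝ, 1 < m ∧ ∃ C : ℝ, 0 < C ∧
    (∀ x, |f x| ≤ C * |x| ^ m) ∧ (∀ x, |deriv f x| ≤ C * |x| ^ (m - 1))
  map_zero : f 0 = 0
  deriv_zero : deriv f 0 = 0
  primitive_nonpos : ∀ x : ℝ, (∫ ξ in (0 : ℝ)..x, f ξ) ≤ 0

/-- The assumptions on the forcing `h`: a continuously differentiable map from the time axis to
`L²(0, π)` which is periodic with period `τ`. (By periodicity `‖h(t)‖` and `‖h_t(t)‖` are then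
bounded.) -/
structure ForcingAssumption (τ : ℝ) (h : ℝ → L2) : Prop where
  period_pos : 0 < τ
  periodic : Function.Periodic h τ
  contDiff : ContDiff ℝ 1 h

/-- The function `x ↦ f(w(x)) + ε g(x)` on `(0, π)`. -/
def load (f : ℝ → ℝ) (ε : ℝ) (w g : L2) : ℝ → ℝ :=
  fun x => f (w x) + ε * g x

/-- `(u₀, v₀) ∈ D(A)`, the domain of the linear beam operator in `H¹₀(0, π) × L²(0, π)`:
`u₀ ∈ H²(0, π) ∩ H¹₀(0, π)` and `v₀ ∈ H¹₀(0, π)`. -/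
def MemDomain (u₀ v₀ : L2) : Prop :=
  ∃ ux uxx vx : L2,
    IsWeakDerivZero u₀ ux ∧ IsWeakDeriv ux uxx ∧ IsWeakDerivZero v₀ vx

/-- `(u, v)`, with `v = u_t`, is a classical solution of the beam equation on the time interval
`J`: `t ↦ (u(t), v(t))` is continuously differentiable from `J` to `H¹₀(0, π) × L²(0, π)`, with
values in `D(A)`, and at every time `t ∈ J` the equation holds. Here `u_xxxx` and `u_ttxx` are
understood by transposition: the equation is multiplied by a smooth `φ` vanishing at `0` and `π`
and integrated by parts, which uses `u_xx = u_tt = 0` at the end points (hinged ends).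
The space derivatives of `u`, `v` are `ux`, `uxx`, `vx`, and `a` is `v_t = u_tt`. -/
def IsClassicalSolution (p : BeamParams) (f : ℝ → ℝ) (ε : ℝ) (h : ℝ → L2) (J : Set ℝ)
    (u v : ℝ → L2) : Prop :=
  ∃ ux uxx vx a : ℝ → L2,
    -- `(u(t), v(t)) ∈ D(A)`
    (∀ t ∈ J, IsWeakDerivZero (u t) (ux t) ∧ IsWeakDeriv (ux t) (uxx t) ∧
      IsWeakDerivZero (v t) (vx t)) ∧
    -- `u` is `C¹` into `H¹₀` with derivative `v`
    (∀ t ∈ J, HasDerivWithinAt u (v t) J t ∧ HasDerivWithinAt ux (vx t) J t) ∧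
    ContinuousOn v J ∧ ContinuousOn vx J ∧
    -- `v` is `C¹` into `L²` with derivative `a`
    (∀ t ∈ J, HasDerivWithinAt v (a t) J t) ∧ ContinuousOn a J ∧
    -- the equation of motion
    ∀ t ∈ J, ∀ φ : ℝ → ℝ, ContDiff ℝ ∞ φ → φ 0 = 0 → φ Real.pi = 0 →
      pair (a t) φ - p.μ * pair (a t) (deriv (deriv φ)) =
        - p.α * pair (uxx t) (deriv (deriv φ)) - p.β * pair (vx t) (deriv φ)
          - p.γ * pair (u t) φ - p.δ * pair (v t) φ + pair (load f ε (u t) (h t)) φ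

/-- The `n`-th coefficient of `w` in its Fourier sine series `∑ ŵₙ sin(n x)`. -/
def sineCoeff (n : ℕ) (w : ℝ → ℝ) : ℝ :=
  2 / Real.pi * pair w (fun x => Real.sin (n * x))

/-- The linear beam operator
`A (u, v) = (v, M⁻¹(-(α ∂⁴ + γ) u + (β ∂² - δ) v))`, `M = 1 - μ ∂²`, leaves the span of
`(sin(n ·), 0)` and `(0, sin(n ·))` invariant; this is its matrix there. -/
def modeMatrix (p : BeamParams) (n : ℕ) : Matrix (Fin 2) (Fin 2) ℝ :=
  !![0, 1;
     - (p.α * (n : ℝ) ^ 4 + p.γ) / (1 + p.μ * (n : ℝ) ^ 2),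
     - (p.β * (n : ℝ) ^ 2 + p.δ) / (1 + p.μ * (n : ℝ) ^ 2)]

/-- `(u, v)` is a mild solution on the time interval `J` (which starts at `0`): it is continuous
from `J` to `H¹₀(0, π) × L²(0, π)` and
`U(t) = e^{tA} U(0) + ∫₀ᵗ e^{(t-s)A} (0, M⁻¹(f(u(s)) + ε h(s))) ds` for `U = (u, v)`. The identity
is written for the sine coefficients, on which `e^{tA}` acts as `exp (t • modeMatrix p n)` and
`M⁻¹` as multiplication by `1 / (1 + μ n²)`. -/
def IsMildSolution (p : BeamParams) (f : ℝ → ℝ) (ε : ℝ) (h : ℝ → L2) (J : Set ℝ)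
    (u v : ℝ → L2) : Prop :=
  (∃ ux : ℝ → L2, (∀ t ∈ J, IsWeakDerivZero (u t) (ux t)) ∧ ContinuousOn ux J) ∧
  ContinuousOn u J ∧ ContinuousOn v J ∧
  ∀ t ∈ J, ∀ n : ℕ, 1 ≤ n →
    ![sineCoeff n (u t), sineCoeff n (v t)] =
      (NormedSpace.exp (t • modeMatrix p n)).mulVec
          ![sineCoeff n (u 0), sineCoeff n (v 0)] +
        ∫ s in (0 : ℝ)..t, (NormedSpace.exp ((t - s) • modeMatrix p n)).mulVec
          ![0, sineCoeff n (load f ε (u s) (h s)) / (1 + p.μ * (n : ℝ) ^ 2)]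

end

end RayleighBeam

/-!
In the sine basis the beam equation decouples up to the load: with `k = n + 1`, the coefficients
satisfy `uₙ' = vₙ` and `(1 + μ k²) vₙ' = -(α k⁴ + γ) uₙ - (β k² + δ) vₙ + gₙ`. In the energy
coordinates `ζₙ = √(α k⁴ + γ) uₙ + i √(1 + μ k²) vₙ` this is
`ζₙ' = -i σₙ ζₙ + i (gₙ / √(1 + μ k²) - dₙ Im ζₙ)` with real frequencies `σₙ` and bounded damping
rates `dₙ`. Square summability of `ζ` means `(u, v) ∈ D(A)`, and `‖ζ‖² / 2` is the energy of the
linear equation.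

Existence. Because `M⁻¹ = (1 - μ ∂²)⁻¹` gains two derivatives, the load acts boundedly from
`L²(0, π)` into this energy space. In the frame rotating with the frequencies `σₙ`, which is given
by a strongly continuous unitary group (`rotation`), the equation with a Lipschitz force is therefore
an ordinary differential equation with Lipschitz right-hand side in a Hilbert space, solvable on
every compact interval (`exists_isModalSolution_of_lipschitz`). The force `f` is only locally
Lipschitz. It is replaced by a globally Lipschitz force which agrees with `f` on `[-R, R]` and still
has a nonpositive primitive (`exists_isTruncation`). The potential energy is then nonnegative, so
the energy balance and Grönwall's inequality bound the solution on `[0, T]` independently of `R`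
(`energy_le_gronwallBound`), and by the one-dimensional Sobolev inequality (`exists_sup_bound`) the
truncation is not felt if `R` is large. Since the solution takes its values in the energy space, it
is a classical one (`IsModalSolution.isClassicalSolution`).

Uniqueness. Testing with sines, respectively differentiating the variation of constants formula,
shows that classical and mild solutions satisfy the mode equations (`SolvesModes`). For these,
summing the `H¹₀ × L²` energies of the modes of a difference of two solutions and Grönwall's
inequality give uniqueness (`SolvesModes.unique`); no regularity beyond that of mild solutions
is used.
-/

namespace RayleighBeam

noncomputable section

open MeasureTheory Set Filter Topology
open scoped ContDiff InnerProductSpace NNReal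

/-! ### Continuous functions as elements of `L²(0, π)` -/

lemma memLp_of_continuous {φ : ℝ → ℝ} (hφ : Continuous φ) :
    MemLp φ 2 (volume.restrict (Ioo (0 : ℝ) Real.pi)) := by
  obtain ⟨C, hC⟩ := (isCompact_Icc (a := (0 : ℝ)) (b := Real.pi)).exists_bound_of_continuousOn
    hφ.continuousOn
  refine MemLp.of_bound hφ.aestronglyMeasurable C ?_
  exact ae_restrict_of_forall_mem measurableSet_Ioo fun x hx => hC x (Ioo_subset_Icc_self hx)

/-- The class in `L²(0, π)` of a continuous function. -/
def ofContinuous (φ : ℝ → ℝ) (hφ : Continuous φ) : L2 := (memLp_of_continuous hφ).toLp φ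

lemma coeFn_ofContinuous {φ : ℝ → ℝ} (hφ : Continuous φ) :
    ofContinuous φ hφ =ᵐ[volume.restrict (Ioo (0 : ℝ) Real.pi)] φ :=
  (memLp_of_continuous hφ).coeFn_toLp

lemma pair_congr {w w' φ : ℝ → ℝ} (h : w =ᵐ[volume.restrict (Ioo (0 : ℝ) Real.pi)] w') :
    pair w φ = pair w' φ :=
  integral_congr_ae (h.mono fun x hx => by simp only [hx])

lemma inner_ofContinuous {φ : ℝ → ℝ} (hφ : Continuous φ) (w : L2) :
    ⟪ofContinuous φ hφ, w⟫_ℝ = pair w φ := by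
  rw [L2.inner_def]
  refine integral_congr_ae ((coeFn_ofContinuous hφ).mono fun x hx => ?_)
  simp [hx]

lemma integrable_mul_continuous (w : L2) {φ : ℝ → ℝ} (hφ : Continuous φ) :
    Integrable (fun x => w x * φ x) (volume.restrict (Ioo (0 : ℝ) Real.pi)) :=
  (Lp.memLp w).integrable_mul (memLp_of_continuous hφ)

/-! ### The sine basis and the orthonormal cosines -/

/-- The wave number of the mode with index `n`; indices start at `0`, wave numbers at `1`. -/
def waveNum (n : ℕ) : ℝ := n + 1

lemma one_le_waveNum (n : ℕ) : 1 ≤ waveNum n := by simp [waveNum]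

lemma waveNum_pos (n : ℕ) : 0 < waveNum n := by unfold waveNum; positivity

lemma sin_waveNum_mul_pi (n : ℕ) : Real.sin (waveNum n * Real.pi) = 0 := by
  have := Real.sin_nat_mul_pi (n + 1)
  simpa [waveNum] using this

/-- The normalized sine `√(2/π) sin((n+1) x)`. -/
def sinMode (n : ℕ) (x : ℝ) : ℝ := √(2 / Real.pi) * Real.sin (waveNum n * x)

/-- The normalized cosine `√(2/π) cos((n+1) x)`. -/
def cosMode (n : ℕ) (x : ℝ) : ℝ := √(2 / Real.pi) * Real.cos (waveNum n * x)

lemma contDiff_sinMode (n : ℕ) : ContDiff ℝ ∞ (sinMode n) := by unfold sinMode; fun_prop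

lemma contDiff_cosMode (n : ℕ) : ContDiff ℝ ∞ (cosMode n) := by unfold cosMode; fun_prop

lemma continuous_sinMode (n : ℕ) : Continuous (sinMode n) := (contDiff_sinMode n).continuous

lemma continuous_cosMode (n : ℕ) : Continuous (cosMode n) := (contDiff_cosMode n).continuous

lemma sinMode_zero (n : ℕ) : sinMode n 0 = 0 := by simp [sinMode]

lemma sinMode_pi (n : ℕ) : sinMode n Real.pi = 0 := by simp [sinMode, sin_waveNum_mul_pi]

lemma hasDerivAt_sinMode (n : ℕ) (x : ℝ) : HasDerivAt (sinMode n) (waveNum n * cosMode n x) x := by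
  have := (((hasDerivAt_id x).const_mul (waveNum n)).sin).const_mul √(2 / Real.pi)
  refine this.congr_deriv ?_
  simp only [cosMode, id]; ring

lemma hasDerivAt_cosMode (n : ℕ) (x : ℝ) :
    HasDerivAt (cosMode n) (-(waveNum n * sinMode n x)) x := by
  have := (((hasDerivAt_id x).const_mul (waveNum n)).cos).const_mul √(2 / Real.pi)
  refine this.congr_deriv ?_
  simp only [sinMode, id]; ring

lemma deriv_sinMode (n : ℕ) : deriv (sinMode n) = fun x => waveNum n * cosMode n x :=
  funext fun x => (hasDerivAt_sinMode n x).deriv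

lemma deriv_cosMode (n : ℕ) : deriv (cosMode n) = fun x => -(waveNum n * sinMode n x) :=
  funext fun x => (hasDerivAt_cosMode n x).deriv

/-- The normalized sine as an element of `L²(0, π)`. -/
def sinVec (n : ℕ) : L2 := ofContinuous (sinMode n) (continuous_sinMode n)

/-- The normalized cosine as an element of `L²(0, π)`. -/
def cosVec (n : ℕ) : L2 := ofContinuous (cosMode n) (continuous_cosMode n)

lemma inner_sinVec (n : ℕ) (w : L2) : ⟪sinVec n, w⟫_ℝ = pair w (sinMode n) :=
  inner_ofContinuous _ w

lemma inner_cosVec (n : ℕ) (w : L2) : ⟪cosVec n, w⟫_ℝ = pair w (cosMode n) :=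
  inner_ofContinuous _ w

lemma integral_cos_int_mul (m : ℤ) :
    ∫ x in (0 : ℝ)..Real.pi, Real.cos (m * x) = if m = 0 then Real.pi else 0 := by
  split_ifs with hm
  · simp [hm]
  · have h : (m : ℝ) ≠ 0 := by exact_mod_cast hm
    rw [intervalIntegral.integral_comp_mul_left _ h]
    simp [Real.sin_int_mul_pi]

lemma pair_eq_intervalIntegral (w φ : ℝ → ℝ) :
    pair w φ = ∫ x in (0 : ℝ)..Real.pi, w x * φ x := by
  rw [pair, intervalIntegral.integral_of_le Real.pi_pos.le, integral_Ioc_eq_integral_Ioo]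

lemma sq_sqrt_two_div_pi : √(2 / Real.pi) * √(2 / Real.pi) = 2 / Real.pi :=
  Real.mul_self_sqrt (by positivity)

lemma inner_sinVec_sinVec (i j : ℕ) : ⟪sinVec i, sinVec j⟫_ℝ = if i = j then 1 else 0 := by
  rw [inner_sinVec, sinVec, pair_congr (coeFn_ofContinuous _), pair_eq_intervalIntegral]
  have h : ∀ x, sinMode j x * sinMode i x = 1 / Real.pi *
      (Real.cos (((i - j : ℤ) : ℝ) * x) - Real.cos (((i + j + 2 : ℤ) : ℝ) * x)) := by
    intro x
    have e1 : ((i - j : ℤ) : ℝ) * x = waveNum i * x - waveNum j * x := by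
      simp [waveNum]; ring
    have e2 : ((i + j + 2 : ℤ) : ℝ) * x = waveNum i * x + waveNum j * x := by
      simp [waveNum]; ring
    rw [e1, e2, Real.cos_sub, Real.cos_add, sinMode, sinMode]
    calc _ = (√(2 / Real.pi) * √(2 / Real.pi)) *
          (Real.sin (waveNum j * x) * Real.sin (waveNum i * x)) := by ring
      _ = _ := by rw [sq_sqrt_two_div_pi]; ring
  simp_rw [h]
  rw [intervalIntegral.integral_const_mul, intervalIntegral.integral_sub
    (by apply Continuous.intervalIntegrable; fun_prop)
    (by apply Continuous.intervalIntegrable; fun_prop), integral_cos_int_mul, integral_cos_int_mul,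
    if_neg (by omega : ¬ ((i : ℤ) + j + 2 = 0))]
  by_cases hij : i = j
  · rw [if_pos (by omega), if_pos hij]; field_simp; simp
  · rw [if_neg (by omega), if_neg hij]; simp

lemma inner_cosVec_cosVec (i j : ℕ) : ⟪cosVec i, cosVec j⟫_ℝ = if i = j then 1 else 0 := by
  rw [inner_cosVec, cosVec, pair_congr (coeFn_ofContinuous _), pair_eq_intervalIntegral]
  have h : ∀ x, cosMode j x * cosMode i x = 1 / Real.pi *
      (Real.cos (((i - j : ℤ) : ℝ) * x) + Real.cos (((i + j + 2 : ℤ) : ℝ) * x)) := by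
    intro x
    have e1 : ((i - j : ℤ) : ℝ) * x = waveNum i * x - waveNum j * x := by
      simp [waveNum]; ring
    have e2 : ((i + j + 2 : ℤ) : ℝ) * x = waveNum i * x + waveNum j * x := by
      simp [waveNum]; ring
    rw [e1, e2, Real.cos_sub, Real.cos_add, cosMode, cosMode]
    calc _ = (√(2 / Real.pi) * √(2 / Real.pi)) *
          (Real.cos (waveNum j * x) * Real.cos (waveNum i * x)) := by ring
      _ = _ := by rw [sq_sqrt_two_div_pi]; ring
  simp_rw [h]
  rw [intervalIntegral.integral_const_mul, intervalIntegral.integral_add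
    (by apply Continuous.intervalIntegrable; fun_prop)
    (by apply Continuous.intervalIntegrable; fun_prop), integral_cos_int_mul, integral_cos_int_mul,
    if_neg (by omega : ¬ ((i : ℤ) + j + 2 = 0))]
  by_cases hij : i = j
  · rw [if_pos (by omega), if_pos hij]; field_simp; simp
  · rw [if_neg (by omega), if_neg hij]; simp

lemma orthonormal_sinVec : Orthonormal ℝ sinVec :=
  orthonormal_iff_ite.2 inner_sinVec_sinVec

lemma orthonormal_cosVec : Orthonormal ℝ cosVec :=
  orthonormal_iff_ite.2 inner_cosVec_cosVec

/-- If all sine coefficients of `w` vanish, then `w` is orthogonal to `sin(n x) cos(x)^j`: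
multiplication by `cos x` turns a sine into a combination of sines. -/
lemma integral_mul_sin_mul_cos_pow {w : L2} (hw : ∀ n, pair w (sinMode n) = 0) (j n : ℕ) :
    ∫ x in Ioo (0 : ℝ) Real.pi, w x * (Real.sin (n * x) * Real.cos x ^ j) = 0 := by
  induction j generalizing n with
  | zero =>
    rcases n with _ | n
    · simp
    · have h := hw n
      have h2 : √(2 / Real.pi) ≠ 0 := by positivity
      have h3 : pair w (sinMode n) = √(2 / Real.pi) *
          ∫ x in Ioo (0 : ℝ) Real.pi, w x * Real.sin (((n + 1 : ℕ) : ℝ) * x) := by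
        rw [pair, ← integral_const_mul]
        refine integral_congr_ae (Eventually.of_forall fun x => ?_)
        simp only [sinMode, waveNum]; push_cast; ring
      rw [h3] at h
      simpa using (mul_eq_zero.1 h).resolve_left h2
  | succ j ih =>
    rcases n with _ | n
    · simp
    · have e : ∀ x, w x * (Real.sin (((n + 1 : ℕ) : ℝ) * x) * Real.cos x ^ (j + 1)) =
          1 / 2 * (w x * (Real.sin (((n + 2 : ℕ) : ℝ) * x) * Real.cos x ^ j)) +
          1 / 2 * (w x * (Real.sin ((n : ℝ) * x) * Real.cos x ^ j)) := by
        intro x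
        have e1 : ((n + 2 : ℕ) : ℝ) * x = ((n + 1 : ℕ) : ℝ) * x + x := by push_cast; ring
        have e2 : (n : ℝ) * x = ((n + 1 : ℕ) : ℝ) * x - x := by push_cast; ring
        rw [e1, e2, Real.sin_add, Real.sin_sub]; ring
      simp_rw [e]
      rw [integral_add, integral_const_mul, integral_const_mul, ih, ih]
      · simp
      · exact (integrable_mul_continuous w (by fun_prop)).const_mul _
      · exact (integrable_mul_continuous w (by fun_prop)).const_mul _

/-- The sines are complete in `L²(0, π)`. By the Weierstrass theorem in the variable `cos x`, an
element with vanishing sine coefficients is orthogonal to `g(x) sin x` for all continuous `g`. -/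
lemma eq_zero_of_pair_sinMode_eq_zero {w : L2} (hw : ∀ n, pair w (sinMode n) = 0) : w = 0 := by
  -- orthogonality to `p(cos x) sin x` for polynomials `p`
  have hpoly : ∀ p : Polynomial ℝ,
      ∫ x in Ioo (0 : ℝ) Real.pi, w x * (Real.sin x * p.eval (Real.cos x)) = 0 := by
    intro p
    have e : ∀ x, w x * (Real.sin x * p.eval (Real.cos x)) = ∑ j ∈ Finset.range (p.natDegree + 1),
        p.coeff j * (w x * (Real.sin (((1 : ℕ) : ℝ) * x) * Real.cos x ^ j)) := by
      intro x
      rw [Polynomial.eval_eq_sum_range, Finset.mul_sum, Finset.mul_sum]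
      refine Finset.sum_congr rfl fun j _ => ?_
      simp; ring
    simp_rw [e]
    rw [integral_finsetSum]
    · simp [-Nat.cast_one, integral_const_mul, integral_mul_sin_mul_cos_pow hw]
    · intro j _
      exact (integrable_mul_continuous w (by fun_prop)).const_mul _
  have hw1 : Integrable (fun x => w x * 1) (volume.restrict (Ioo (0 : ℝ) Real.pi)) :=
    integrable_mul_continuous w continuous_const
  have hcont : ∀ g : ℝ → ℝ, Continuous g →
      ∫ x in Ioo (0 : ℝ) Real.pi, w x * (Real.sin x * g x) = 0 := by
    intro g hg
    set A := ∫ x in Ioo (0 : ℝ) Real.pi, |w x * 1| with hA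
    have hA0 : 0 ≤ A := integral_nonneg fun x => abs_nonneg _
    by_contra hne
    have hpos := abs_pos.2 hne
    set I := ∫ x in Ioo (0 : ℝ) Real.pi, w x * (Real.sin x * g x)
    obtain ⟨p, hp⟩ := exists_polynomial_near_of_continuousOn (-1) 1 (fun y => g (Real.arccos y))
      (by fun_prop) (|I| / (A + 1)) (by positivity)
    have hsub : I = ∫ x in Ioo (0 : ℝ) Real.pi,
        w x * (Real.sin x * (g x - p.eval (Real.cos x))) := by
      refine (sub_zero I).symm.trans ?_
      refine (congrArg (I - ·) (hpoly p).symm).trans ?_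
      refine (integral_sub ?_ ?_).symm.trans ?_
      rotate_left 2
      · refine integral_congr_ae (Eventually.of_forall fun x => ?_)
        simp only; ring
      · exact integrable_mul_continuous w (by fun_prop)
      · exact integrable_mul_continuous w (by fun_prop)
    have hle : |I| ≤ |I| / (A + 1) * A := by
      calc |I| ≤ ∫ x in Ioo (0 : ℝ) Real.pi, |I| / (A + 1) * |w x * 1| := by
            conv_lhs => rw [hsub, ← Real.norm_eq_abs]
            refine norm_integral_le_of_norm_le (hw1.abs.const_mul _) ?_
            refine ae_restrict_of_forall_mem measurableSet_Ioo fun x hx => ?_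
            have h1 := hp (Real.cos x) ⟨Real.neg_one_le_cos x, Real.cos_le_one x⟩
            rw [Real.arccos_cos hx.1.le hx.2.le] at h1
            rw [Real.norm_eq_abs, abs_mul, abs_mul, mul_one, mul_comm (|I| / (A + 1))]
            refine mul_le_mul_of_nonneg_left ?_ (abs_nonneg _)
            calc |Real.sin x| * |g x - p.eval (Real.cos x)|
                ≤ 1 * |g x - p.eval (Real.cos x)| :=
                  mul_le_mul_of_nonneg_right (Real.abs_sin_le_one x) (abs_nonneg _)
              _ ≤ _ := by rw [one_mul, abs_sub_comm]; exact h1.le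
        _ = |I| / (A + 1) * A := by rw [integral_const_mul]
    have : |I| / (A + 1) * A < |I| := by
      rw [div_mul_eq_mul_div, div_lt_iff₀ (by positivity)]
      nlinarith
    linarith
  have hint : IntegrableOn (fun x => w x * Real.sin x) (Ioo (0 : ℝ) Real.pi) :=
    integrable_mul_continuous w (by fun_prop)
  -- hence `w sin = 0` almost everywhere, and `sin` has no zero in the open interval
  have h0 : ∀ᵐ x, x ∈ Ioo (0 : ℝ) Real.pi → w x * Real.sin x = 0 := by
    refine isOpen_Ioo.ae_eq_zero_of_integral_contDiff_smul_eq_zero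
      hint.locallyIntegrableOn fun g hg _ hsupp => ?_
    refine Eq.trans ?_ (hcont g hg.continuous)
    rw [← setIntegral_eq_integral_of_forall_compl_eq_zero (s := Ioo (0 : ℝ) Real.pi)]
    · refine integral_congr_ae (Eventually.of_forall fun x => ?_)
      simp only [smul_eq_mul]; ring
    · intro x hx
      have : g x = 0 := by
        by_contra hgx
        exact hx (hsupp (subset_tsupport g hgx))
      simp [this]
  refine Lp.ext ?_
  have h1 : ∀ᵐ x ∂(volume.restrict (Ioo (0 : ℝ) Real.pi)), w x = 0 := by
    rw [ae_restrict_iff' measurableSet_Ioo]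
    filter_upwards [h0] with x hx hxm
    exact (mul_eq_zero.1 (hx hxm)).resolve_right (Real.sin_pos_of_mem_Ioo hxm).ne'
  filter_upwards [h1, Lp.coeFn_zero ℝ 2 (volume.restrict (Ioo (0 : ℝ) Real.pi))] with x hx h0
  rw [hx, h0]; rfl

/-- The normalized sines form a Hilbert basis of `L²(0, π)`. -/
def sineBasis : HilbertBasis ℕ ℝ L2 :=
  HilbertBasis.mkOfOrthogonalEqBot orthonormal_sinVec <| by
    rw [Submodule.eq_bot_iff]
    intro w hw
    refine eq_zero_of_pair_sinMode_eq_zero fun n => ?_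
    rw [← inner_sinVec]
    exact (Submodule.mem_orthogonal _ _).1 hw _ (Submodule.subset_span ⟨n, rfl⟩)

lemma sineBasis_apply (n : ℕ) : sineBasis n = sinVec n := by
  rw [sineBasis, HilbertBasis.coe_mkOfOrthogonalEqBot]

lemma sineBasis_repr_apply (w : L2) (n : ℕ) : sineBasis.repr w n = pair w (sinMode n) := by
  rw [HilbertBasis.repr_apply_apply, sineBasis_apply, inner_sinVec]

lemma eq_of_pair_sinMode_eq {w w' : L2} (h : ∀ n, pair w (sinMode n) = pair w' (sinMode n)) :
    w = w' := by
  refine sineBasis.repr.injective (lp.ext (funext fun n => ?_))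
  rw [sineBasis_repr_apply, sineBasis_repr_apply, h]

/-- Square summable sequences as coefficients of a series of normalized cosines. -/
def cosSeries : lp (fun _ : ℕ => ℝ) 2 →ₗᵢ[ℝ] L2 :=
  orthonormal_cosVec.orthogonalFamily.linearIsometry

lemma hasSum_cosSeries (x : lp (fun _ : ℕ => ℝ) 2) :
    HasSum (fun n => x n • cosVec n) (cosSeries x) := by
  have := orthonormal_cosVec.orthogonalFamily.hasSum_linearIsometry x
  simp only [LinearIsometry.toSpanSingleton_apply] at this
  exact this

/-- Square summable sequences as coefficients of a series of normalized sines. -/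
def sinSeries : lp (fun _ : ℕ => ℝ) 2 →ₗᵢ[ℝ] L2 := sineBasis.repr.symm.toLinearIsometry

lemma hasSum_sinSeries (x : lp (fun _ : ℕ => ℝ) 2) :
    HasSum (fun n => x n • sinVec n) (sinSeries x) := by
  have := sineBasis.hasSum_repr_symm x
  simp only [sineBasis_apply] at this
  exact this

lemma pair_sinSeries (x : lp (fun _ : ℕ => ℝ) 2) (n : ℕ) :
    pair (sinSeries x) (sinMode n) = x n := by
  rw [← sineBasis_repr_apply]; simp [sinSeries]

lemma sinSeries_repr (w : L2) : sinSeries (sineBasis.repr w) = w := by simp [sinSeries]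

lemma hasSum_inner_sinSeries (x : lp (fun _ : ℕ => ℝ) 2) (w : L2) :
    HasSum (fun n => x n * pair w (sinMode n)) ⟪sinSeries x, w⟫_ℝ := by
  have := (innerSL ℝ w).hasSum (hasSum_sinSeries x)
  simpa [inner_smul_right, real_inner_comm _ w, inner_sinVec, real_inner_smul_left] using this

lemma hasSum_inner_cosSeries (x : lp (fun _ : ℕ => ℝ) 2) (w : L2) :
    HasSum (fun n => x n * pair w (cosMode n)) ⟪cosSeries x, w⟫_ℝ := by
  have := (innerSL ℝ w).hasSum (hasSum_cosSeries x)
  simpa [inner_smul_right, real_inner_comm _ w, inner_cosVec, real_inner_smul_left] using this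

/-! ### Weak derivatives in terms of sine and cosine coefficients -/

lemma pair_const_mul (w φ : ℝ → ℝ) (c : ℝ) : pair w (fun x => c * φ x) = c * pair w φ := by
  rw [pair, pair, ← integral_const_mul]
  exact integral_congr_ae (Eventually.of_forall fun _ => by ring)

lemma pair_comm (w φ : ℝ → ℝ) : pair w φ = pair φ w :=
  integral_congr_ae (Eventually.of_forall fun _ => mul_comm _ _)

lemma IsWeakDerivZero.pair_cosMode {w w' : L2} (h : IsWeakDerivZero w w') (n : ℕ) :
    pair w' (cosMode n) = waveNum n * pair w (sinMode n) := by
  have := h (cosMode n) (contDiff_cosMode n)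
  have e : deriv (cosMode n) = fun x => (-waveNum n) * sinMode n x := by
    rw [deriv_cosMode]; ext x; ring
  rw [e, pair_const_mul] at this
  linarith

lemma IsWeakDeriv.pair_sinMode {w w' : L2} (h : IsWeakDeriv w w') (n : ℕ) :
    pair w' (sinMode n) = -(waveNum n * pair w (cosMode n)) := by
  have := h (sinMode n) (contDiff_sinMode n) (sinMode_zero n) (sinMode_pi n)
  rw [deriv_sinMode, pair_const_mul] at this
  linarith

lemma pair_deriv_sinMode {φ : ℝ → ℝ} (hφ : ContDiff ℝ ∞ φ) (n : ℕ) :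
    pair (deriv φ) (sinMode n) = -(waveNum n * pair φ (cosMode n)) := by
  have hd : Continuous (deriv φ) := hφ.continuous_deriv (by simp)
  have h := intervalIntegral.integral_mul_deriv_eq_deriv_mul (a := 0) (b := Real.pi)
    (u := sinMode n) (v := φ) (fun x _ => hasDerivAt_sinMode n x)
    (fun x _ => (hφ.differentiable (by simp) x).hasDerivAt)
    ((continuous_const.mul (continuous_cosMode n)).intervalIntegrable _ _)
    (hd.intervalIntegrable _ _)
  rw [sinMode_zero, sinMode_pi] at h
  rw [pair_comm, pair_eq_intervalIntegral, h, pair_comm φ, pair_eq_intervalIntegral,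
    ← intervalIntegral.integral_const_mul]
  simp [mul_assoc]

lemma pair_deriv_cosMode {φ : ℝ → ℝ} (hφ : ContDiff ℝ ∞ φ) (h0 : φ 0 = 0) (hπ : φ Real.pi = 0)
    (n : ℕ) : pair (deriv φ) (cosMode n) = waveNum n * pair φ (sinMode n) := by
  have hd : Continuous (deriv φ) := hφ.continuous_deriv (by simp)
  have h := intervalIntegral.integral_mul_deriv_eq_deriv_mul (a := 0) (b := Real.pi)
    (u := cosMode n) (v := φ) (fun x _ => hasDerivAt_cosMode n x)
    (fun x _ => (hφ.differentiable (by simp) x).hasDerivAt)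
    ((continuous_const.mul (continuous_sinMode n)).neg.intervalIntegrable _ _)
    (hd.intervalIntegrable _ _)
  rw [h0, hπ] at h
  rw [pair_comm, pair_eq_intervalIntegral, h, pair_comm φ, pair_eq_intervalIntegral,
    ← intervalIntegral.integral_const_mul]
  simp [mul_assoc]

lemma isWeakDerivZero_sinSeries {x y : lp (fun _ : ℕ => ℝ) 2} (h : ∀ n, y n = waveNum n * x n) :
    IsWeakDerivZero (sinSeries x) (cosSeries y) := by
  intro φ hφ
  have hd : Continuous (deriv φ) := hφ.continuous_deriv (by simp)
  rw [← inner_ofContinuous hd, ← inner_ofContinuous hφ.continuous, real_inner_comm,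
    real_inner_comm (cosSeries y)]
  refine (hasSum_inner_sinSeries x _).unique ?_
  refine ((hasSum_inner_cosSeries y (ofContinuous φ hφ.continuous)).neg).congr_fun fun n => ?_
  rw [pair_congr (coeFn_ofContinuous hd), pair_deriv_sinMode hφ,
    pair_congr (coeFn_ofContinuous hφ.continuous), h]
  ring

lemma isWeakDeriv_cosSeries {x y : lp (fun _ : ℕ => ℝ) 2} (h : ∀ n, y n = -(waveNum n * x n)) :
    IsWeakDeriv (cosSeries x) (sinSeries y) := by
  intro φ hφ h0 hπ
  have hd : Continuous (deriv φ) := hφ.continuous_deriv (by simp)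
  rw [← inner_ofContinuous hd, ← inner_ofContinuous hφ.continuous, real_inner_comm,
    real_inner_comm (sinSeries y)]
  refine (hasSum_inner_cosSeries x _).unique ?_
  refine ((hasSum_inner_sinSeries y (ofContinuous φ hφ.continuous)).neg).congr_fun fun n => ?_
  rw [pair_congr (coeFn_ofContinuous hd), pair_deriv_cosMode hφ h0 hπ,
    pair_congr (coeFn_ofContinuous hφ.continuous), h]
  ring

lemma exists_lp_of_summable_sq {a : ℕ → ℝ} (ha : Summable fun n => a n ^ 2) :
    ∃ x : lp (fun _ : ℕ => ℝ) 2, ∀ n, x n = a n := by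
  have hm : Memℓp (E := fun _ : ℕ => ℝ) a 2 := by
    rw [memℓp_gen_iff (by simp)]
    simpa using ha
  exact ⟨⟨a, hm⟩, fun n => rfl⟩

lemma summable_sq_pair_cosMode (w : L2) : Summable fun n => pair w (cosMode n) ^ 2 := by
  have := orthonormal_cosVec.inner_products_summable w
  simpa [inner_cosVec] using this

lemma sum_sq_pair_cosMode_le (w : L2) (s : Finset ℕ) :
    ∑ n ∈ s, pair w (cosMode n) ^ 2 ≤ ‖w‖ ^ 2 := by
  have := orthonormal_cosVec.sum_inner_products_le (s := s) w
  simpa [inner_cosVec] using this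

lemma sum_sq_pair_sinMode_le (w : L2) (s : Finset ℕ) :
    ∑ n ∈ s, pair w (sinMode n) ^ 2 ≤ ‖w‖ ^ 2 := by
  have := orthonormal_sinVec.sum_inner_products_le (s := s) w
  simpa [inner_sinVec] using this

lemma hasSum_sq_pair_sinMode (w : L2) :
    HasSum (fun n => pair w (sinMode n) ^ 2) (‖w‖ ^ 2) := by
  have := hasSum_inner_sinSeries (sineBasis.repr w) w
  rw [sinSeries_repr, real_inner_self_eq_norm_sq] at this
  refine this.congr_fun fun n => ?_
  rw [sineBasis_repr_apply]; ring

/-- The one-dimensional Sobolev inequality on `H¹₀(0, π)`. -/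
lemma exists_sup_bound : ∃ C : ℝ, 0 ≤ C ∧ ∀ u ux : L2, IsWeakDerivZero u ux →
    ∀ᵐ x ∂(volume.restrict (Ioo (0 : ℝ) Real.pi)), |u x| ≤ C * ‖ux‖ := by
  have hsum : Summable fun n : ℕ => (1 / waveNum n) ^ 2 := by
    have := (summable_nat_add_iff 1).2 (Real.summable_one_div_nat_pow.2 one_lt_two)
    refine this.congr fun n => ?_
    simp [waveNum]
  set S := ∑' n : ℕ, (1 / waveNum n) ^ 2 with hS
  refine ⟨√(2 / Real.pi) * √S, by positivity, fun u ux h => ?_⟩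
  set a : ℕ → ℝ := fun n => pair u (sinMode n) with ha
  have hbound : ∀ N : ℕ, ∑ n ∈ Finset.range N, |a n| ≤ √S * ‖ux‖ := by
    intro N
    have e : ∀ n, |a n| = 1 / waveNum n * |pair ux (cosMode n)| := by
      intro n
      rw [h.pair_cosMode, abs_mul, abs_of_pos (waveNum_pos n), ← mul_assoc,
        one_div_mul_cancel (waveNum_pos n).ne', one_mul]
    simp_rw [e]
    refine (Real.sum_mul_le_sqrt_mul_sqrt _ _ _).trans ?_
    refine mul_le_mul (Real.sqrt_le_sqrt (hsum.sum_le_tsum _ fun n _ => sq_nonneg _)) ?_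
      (Real.sqrt_nonneg _) (Real.sqrt_nonneg _)
    rw [← Real.sqrt_sq (norm_nonneg ux)]
    refine Real.sqrt_le_sqrt ?_
    simpa using sum_sq_pair_cosMode_le ux (Finset.range N)
  have hlim : Tendsto (fun N => ∑ n ∈ Finset.range N, a n • sinVec n) atTop (𝓝 u) := by
    have := (hasSum_sinSeries (sineBasis.repr u)).tendsto_sum_nat
    rw [sinSeries_repr] at this
    simpa only [sineBasis_repr_apply] using this
  -- the partial sums are bounded pointwise, and a subsequence converges almost everywhere
  obtain ⟨ns, -, hns⟩ := (tendstoInMeasure_of_tendsto_Lp hlim).exists_seq_tendsto_ae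
  have hpart : ∀ N : ℕ, ∀ᵐ x ∂(volume.restrict (Ioo (0 : ℝ) Real.pi)),
      (∑ n ∈ Finset.range N, a n • sinVec n : L2) x = ∑ n ∈ Finset.range N, a n * sinMode n x := by
    intro N
    induction N with
    | zero =>
      filter_upwards [Lp.coeFn_zero ℝ 2 (volume.restrict (Ioo (0 : ℝ) Real.pi))] with x hx
      simpa using hx
    | succ N ih =>
      rw [Finset.sum_range_succ]
      filter_upwards [ih, Lp.coeFn_add (∑ n ∈ Finset.range N, a n • sinVec n) (a N • sinVec N),
        Lp.coeFn_smul (a N) (sinVec N), coeFn_ofContinuous (continuous_sinMode N)]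
        with x h1 h2 h3 h4
      rw [Finset.sum_range_succ, h2, Pi.add_apply, h1, h3, Pi.smul_apply, sinVec, h4, smul_eq_mul]
  filter_upwards [hns, ae_all_iff.2 hpart] with x hx hp
  refine le_of_tendsto hx.abs (Eventually.of_forall fun j => ?_)
  rw [hp]
  calc |∑ n ∈ Finset.range (ns j), a n * sinMode n x|
      ≤ ∑ n ∈ Finset.range (ns j), |a n| * √(2 / Real.pi) := by
        refine (Finset.abs_sum_le_sum_abs _ _).trans (Finset.sum_le_sum fun n _ => ?_)
        rw [abs_mul]
        refine mul_le_mul_of_nonneg_left ?_ (abs_nonneg _)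
        rw [sinMode, abs_mul, abs_of_nonneg (Real.sqrt_nonneg _)]
        exact mul_le_of_le_one_right (Real.sqrt_nonneg _) (Real.abs_sin_le_one _)
    _ = √(2 / Real.pi) * ∑ n ∈ Finset.range (ns j), |a n| := by
        rw [← Finset.sum_mul, mul_comm]
    _ ≤ √(2 / Real.pi) * (√S * ‖ux‖) :=
        mul_le_mul_of_nonneg_left (hbound _) (Real.sqrt_nonneg _)
    _ = _ := by ring

/-! ### Diagonal operators on square summable sequences -/

section Diagonal

variable {E F : Type*} [NormedAddCommGroup E] [NormedSpace ℝ E] [NormedAddCommGroup F]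
  [NormedSpace ℝ F]

/-- The diagonal operator `(xₙ) ↦ (Aₙ xₙ)` on square summable sequences, for a bounded sequence of
operators `Aₙ`. -/
def diagOp (A : ℕ → E →L[ℝ] F) (C : ℝ) (hA : ∀ n, ‖A n‖ ≤ C) :
    lp (fun _ : ℕ => E) 2 →L[ℝ] lp (fun _ : ℕ => F) 2 :=
  have hC : 0 ≤ C := (norm_nonneg _).trans (hA 0)
  have hle : ∀ (x : lp (fun _ : ℕ => E) 2) (n : ℕ), ‖A n (x n)‖ ≤ ‖(C • x) n‖ := fun x n => by
    rw [lp.coeFn_smul, Pi.smul_apply, norm_smul, Real.norm_of_nonneg hC]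
    exact (A n).le_of_opNorm_le (hA n) _
  have hmem : ∀ x : lp (fun _ : ℕ => E) 2, Memℓp (E := fun _ : ℕ => F) (fun n => A n (x n)) 2 :=
    fun x => by
      have h := lp.memℓp (C • x)
      rw [memℓp_gen_iff (by simp)] at h ⊢
      refine h.of_nonneg_of_le (fun n => by positivity) fun n => ?_
      exact Real.rpow_le_rpow (norm_nonneg _) (hle x n) (by simp)
  LinearMap.mkContinuous
    { toFun := fun x => ⟨fun n => A n (x n), hmem x⟩
      map_add' := fun x y => lp.ext (funext fun n => (A n).map_add _ _)
      map_smul' := fun c x => lp.ext (funext fun n => (A n).map_smul _ _) }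
    C fun x => by
      refine (lp.norm_mono two_ne_zero (y := C • x) (hle x)).trans ?_
      rw [norm_smul, Real.norm_of_nonneg hC]

variable {A : ℕ → E →L[ℝ] F} {C : ℝ} {hA : ∀ n, ‖A n‖ ≤ C}

lemma norm_diagOp_apply_le (x : lp (fun _ : ℕ => E) 2) : ‖diagOp A C hA x‖ ≤ C * ‖x‖ := by
  have hC : 0 ≤ C := (norm_nonneg _).trans (hA 0)
  refine (lp.norm_mono two_ne_zero (y := C • x) fun n => ?_).trans ?_
  · rw [lp.coeFn_smul, Pi.smul_apply, norm_smul, Real.norm_of_nonneg hC]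
    exact (A n).le_of_opNorm_le (hA n) _
  · rw [norm_smul, Real.norm_of_nonneg hC]

end Diagonal

/-- The Hilbert space of square summable complex sequences. -/
abbrev CSeq : Type := lp (fun _ : ℕ => ℂ) 2

/-- The Hilbert space of square summable real sequences. -/
abbrev RSeq : Type := lp (fun _ : ℕ => ℝ) 2

/-- The unitary group that rotates the `n`-th entry with angular velocity `σ n`. -/
def rotation (σ : ℕ → ℝ) (t : ℝ) : CSeq →L[ℝ] CSeq :=
  diagOp (fun n => ContinuousLinearMap.mul ℝ ℂ (Complex.exp (((σ n * t : ℝ) : ℂ) * Complex.I))) 1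
    fun n => by
      refine (ContinuousLinearMap.opNorm_mul_apply_le ℝ ℂ _).trans ?_
      rw [Complex.norm_exp_ofReal_mul_I]

lemma rotation_apply (σ : ℕ → ℝ) (t : ℝ) (x : CSeq) (n : ℕ) :
    rotation σ t x n = Complex.exp (((σ n * t : ℝ) : ℂ) * Complex.I) * x n := rfl

lemma norm_rotation_apply_entry (σ : ℕ → ℝ) (t : ℝ) (x : CSeq) (n : ℕ) :
    ‖rotation σ t x n‖ = ‖x n‖ := by
  rw [rotation_apply, norm_mul, Complex.norm_exp_ofReal_mul_I, one_mul]

lemma norm_rotation (σ : ℕ → ℝ) (t : ℝ) (x : CSeq) : ‖rotation σ t x‖ = ‖x‖ :=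
  le_antisymm (lp.norm_mono two_ne_zero fun n => (norm_rotation_apply_entry σ t x n).le)
    (lp.norm_mono two_ne_zero fun n => (norm_rotation_apply_entry σ t x n).ge)

lemma rotation_rotation_neg (σ : ℕ → ℝ) (t : ℝ) (x : CSeq) :
    rotation σ t (rotation σ (-t) x) = x := by
  refine lp.ext (funext fun n => ?_)
  rw [rotation_apply, rotation_apply, ← mul_assoc, ← Complex.exp_add, ← add_mul,
    ← Complex.ofReal_add]
  simp

lemma rotation_zero (σ : ℕ → ℝ) (x : CSeq) : rotation σ 0 x = x := by
  refine lp.ext (funext fun n => ?_)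
  rw [rotation_apply]
  simp

/-- Strong continuity: on finite sums the rotations are continuous, and the approximation by finite
sums is uniform in time. -/
lemma continuous_rotation_apply (σ : ℕ → ℝ) (x : CSeq) : Continuous fun t => rotation σ t x := by
  have hpart : TendstoUniformly
      (fun (s : Finset ℕ) t => rotation σ t (∑ n ∈ s, lp.single 2 n (x n)))
      (fun t => rotation σ t x) atTop := by
    rw [Metric.tendstoUniformly_iff]
    intro ε hε
    have h := lp.hasSum_single (p := 2) (by simp) x
    filter_upwards [Metric.tendsto_nhds.1 h ε hε] with s hs t
    rw [dist_eq_norm, ← map_sub, norm_rotation, ← dist_eq_norm, dist_comm]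
    exact hs
  refine hpart.continuous (Eventually.of_forall fun s => ?_).frequently
  simp_rw [map_sum]
  refine continuous_finsetSum _ fun n _ => ?_
  have e : ∀ t, rotation σ t (lp.single 2 n (x n)) =
      lp.single 2 n (Complex.exp (((σ n * t : ℝ) : ℂ) * Complex.I) * x n) := by
    intro t
    refine lp.ext (funext fun m => ?_)
    rw [rotation_apply]
    by_cases hm : m = n
    · subst hm; simp
    · simp [hm]
  simp_rw [e]
  exact (lp.isometry_single n).continuous.comp (by fun_prop)

lemma continuousOn_rotation {σ : ℕ → ℝ} {x : ℝ → CSeq} {s : Set ℝ} {θ : ℝ → ℝ} (hθ : Continuous θ)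
    (hx : ContinuousOn x s) : ContinuousOn (fun t => rotation σ (θ t) (x t)) s := by
  intro t ht
  have h1 : Tendsto (fun r => rotation σ (θ r) (x t)) (𝓝[s] t) (𝓝 (rotation σ (θ t) (x t))) :=
    ((continuous_rotation_apply σ (x t)).comp hθ).continuousAt.mono_left nhdsWithin_le_nhds
  have h2 : Tendsto (fun r => rotation σ (θ r) (x r) - rotation σ (θ r) (x t)) (𝓝[s] t) (𝓝 0) := by
    rw [tendsto_zero_iff_norm_tendsto_zero]
    simp_rw [← map_sub, norm_rotation]
    rw [← tendsto_zero_iff_norm_tendsto_zero]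
    exact tendsto_sub_nhds_zero_iff.2 (hx t ht)
  have h3 := h1.add h2
  simp only [add_sub_cancel, add_zero] at h3
  exact h3

/-! ### Ordinary differential equations in Banach spaces -/

section ODE

variable {E : Type*} [NormedAddCommGroup E] [NormedSpace ℝ E]

/-- The radial retraction onto the ball of radius `ρ`. -/
def retraction (ρ : ℝ) (x : E) : E := (ρ / max ρ ‖x‖) • x

lemma retraction_of_norm_le {ρ : ℝ} (hρ : 0 < ρ) {x : E} (hx : ‖x‖ ≤ ρ) : retraction ρ x = x := by
  rw [retraction, max_eq_left hx, div_self hρ.ne', one_smul]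

lemma norm_retraction_le_norm {ρ : ℝ} (hρ : 0 < ρ) (x : E) : ‖retraction ρ x‖ ≤ ‖x‖ := by
  have hm : 0 < max ρ ‖x‖ := lt_max_of_lt_left hρ
  rw [retraction, norm_smul, Real.norm_of_nonneg (by positivity)]
  exact mul_le_of_le_one_left (norm_nonneg _) ((div_le_one hm).2 (le_max_left _ _))

lemma norm_retraction_le {ρ : ℝ} (hρ : 0 < ρ) (x : E) : ‖retraction ρ x‖ ≤ ρ := by
  have hm : 0 < max ρ ‖x‖ := lt_max_of_lt_left hρ
  rw [retraction, norm_smul, Real.norm_of_nonneg (by positivity), div_mul_eq_mul_div,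
    div_le_iff₀ hm]
  exact mul_le_mul_of_nonneg_left (le_max_right _ _) hρ.le

lemma lipschitzWith_retraction {ρ : ℝ} (hρ : 0 < ρ) :
    LipschitzWith 2 (retraction ρ : E → E) := by
  refine LipschitzWith.of_dist_le_mul fun x y => ?_
  have hx : 0 < max ρ ‖x‖ := lt_max_of_lt_left hρ
  have hy : 0 < max ρ ‖y‖ := lt_max_of_lt_left hρ
  rw [dist_eq_norm, dist_eq_norm]
  have e : retraction ρ x - retraction ρ y =
      (ρ / max ρ ‖x‖) • (x - y) + (ρ / max ρ ‖x‖ - ρ / max ρ ‖y‖) • y := by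
    rw [retraction, retraction, smul_sub, sub_smul]; abel
  have h1 : ‖(ρ / max ρ ‖x‖) • (x - y)‖ ≤ ‖x - y‖ := by
    rw [norm_smul, Real.norm_of_nonneg (by positivity)]
    exact mul_le_of_le_one_left (norm_nonneg _) ((div_le_one hx).2 (le_max_left _ _))
  have h2 : ‖(ρ / max ρ ‖x‖ - ρ / max ρ ‖y‖) • y‖ ≤ ‖x - y‖ := by
    have e2 : ρ / max ρ ‖x‖ - ρ / max ρ ‖y‖ =
        ρ * (max ρ ‖y‖ - max ρ ‖x‖) / (max ρ ‖x‖ * max ρ ‖y‖) := by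
      field_simp
    have h3 : |max ρ ‖y‖ - max ρ ‖x‖| ≤ ‖x - y‖ := by
      refine (abs_max_sub_max_le_max _ _ _ _).trans (max_le (by simp) ?_)
      rw [norm_sub_rev]
      exact abs_norm_sub_norm_le y x
    rw [norm_smul, e2, Real.norm_eq_abs, abs_div, abs_mul, abs_of_pos hρ,
      abs_of_pos (mul_pos hx hy), div_mul_eq_mul_div, div_le_iff₀ (mul_pos hx hy)]
    calc ρ * |max ρ ‖y‖ - max ρ ‖x‖| * ‖y‖ ≤ max ρ ‖x‖ * ‖x - y‖ * max ρ ‖y‖ := by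
          gcongr
          · exact le_max_left _ _
          · exact le_max_right _ _
      _ = _ := by ring
  rw [e]
  refine (norm_add_le _ _).trans ?_
  push_cast
  linarith

/-- A differential equation whose right-hand side is globally Lipschitz in space has a solution on
every compact time interval. Outside of the ball in which Grönwall's inequality confines the
solution the right-hand side may be frozen along rays, which makes it bounded and so allows the
Picard-Lindelöf theorem to be applied on the whole interval at once. -/
theorem exists_hasDerivWithinAt_of_lipschitzWith [CompleteSpace E] {G : ℝ → E → E} {T : ℝ}
    (hT : 0 ≤ T) {K : ℝ≥0} (hL : ∀ t ∈ Icc 0 T, LipschitzWith K (G t))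
    (hc : ∀ x, ContinuousOn (fun t => G t x) (Icc 0 T)) (x₀ : E) :
    ∃ η : ℝ → E, η 0 = x₀ ∧ ∀ t ∈ Icc 0 T, HasDerivWithinAt η (G t (η t)) (Icc 0 T) t := by
  obtain ⟨B, hB⟩ := isCompact_Icc.exists_bound_of_continuousOn (hc 0)
  have hB0 : 0 ≤ B := (norm_nonneg _).trans (hB 0 ⟨le_rfl, hT⟩)
  have hgrow : ∀ t ∈ Icc 0 T, ∀ x, ‖G t x‖ ≤ K * ‖x‖ + B := fun t ht x => by
    have h1 := (hL t ht).norm_sub_le x 0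
    rw [sub_zero] at h1
    calc ‖G t x‖ = ‖(G t x - G t 0) + G t 0‖ := by rw [sub_add_cancel]
      _ ≤ _ := (norm_add_le _ _).trans (add_le_add h1 (hB t ht))
  -- a radius which the solution cannot reach
  set ρ := gronwallBound ‖x₀‖ K B T + 1 with hρ_def
  have hmono := gronwallBound_mono (norm_nonneg x₀) hB0 K.coe_nonneg
  have hρ : 0 < ρ := by
    have := hmono hT
    rw [gronwallBound_x0] at this
    have := norm_nonneg x₀
    linarith
  set Gρ : ℝ → E → E := fun t x => G t (retraction ρ x) with hGρ
  set M : ℝ≥0 := K * ⟨ρ, hρ.le⟩ + ⟨B, hB0⟩ with hM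
  have hpl : IsPicardLindelof Gρ (⟨0, le_rfl, hT⟩ : Icc 0 T) x₀ (M * ⟨T, hT⟩) 0 M (K * 2) := by
    refine ⟨fun t ht => ((hL t ht).comp (lipschitzWith_retraction hρ)).lipschitzOnWith,
      fun x _ => hc _, fun t ht x _ => ?_, ?_⟩
    · refine (hgrow t ht _).trans ?_
      have h1 := mul_le_mul_of_nonneg_left (norm_retraction_le hρ x) K.coe_nonneg
      exact add_le_add_left h1 B
    · change (M : ℝ) * max (T - 0) (0 - 0) ≤ (M : ℝ) * T - 0
      rw [sub_zero, sub_zero, sub_zero, max_eq_left hT]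
  obtain ⟨η, hη0, hη⟩ := hpl.exists_eq_forall_mem_Icc_hasDerivWithinAt₀
  have hη0' : η 0 = x₀ := hη0
  refine ⟨η, hη0', fun t ht => ?_⟩
  have hbound := norm_le_gronwallBound_of_norm_deriv_right_le (f := η) (δ := ‖x₀‖) (K := K) (ε := B)
    (fun t ht => (hη t ht).continuousWithinAt)
    (fun t ht => (hη t (Ico_subset_Icc_self ht)).mono_of_mem_nhdsWithin
      (Icc_mem_nhdsGE_of_mem ht)) (by rw [hη0'])
    (fun t ht => by
      refine (hgrow t (Ico_subset_Icc_self ht) _).trans ?_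
      gcongr
      exact norm_retraction_le_norm hρ _) t ht
  have hle : ‖η t‖ ≤ ρ := by
    have := hmono (show t - 0 ≤ T by linarith [ht.2])
    linarith
  have := hη t ht
  simp only [hGρ, retraction_of_norm_le hρ hle] at this
  exact this

/-- A curve is differentiable with derivative `w'` if `w'` is continuous and the derivatives of its
coordinates, with respect to a separating family of functionals, are the coordinates of `w'`. -/
theorem hasDerivWithinAt_of_coordinates [CompleteSpace E] {ι : Type*} (L : ι → E →L[ℝ] ℝ)
    (hsep : ∀ x, (∀ i, L i x = 0) → x = 0) {w w' : ℝ → E} {T : ℝ}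
    (hw' : ContinuousOn w' (Icc 0 T))
    (hd : ∀ i, ∀ t ∈ Icc 0 T, HasDerivWithinAt (fun s => L i (w s)) (L i (w' t)) (Icc 0 T) t) :
    ∀ t ∈ Icc 0 T, HasDerivWithinAt w (w' t) (Icc 0 T) t := by
  intro t ht
  have hT : 0 ≤ T := ht.1.trans ht.2
  -- the integrand, extended continuously to the whole time axis
  set W := IccExtend hT ((Icc 0 T).domRestrict w') with hW
  have hWc : Continuous W := (continuousOn_iff_continuous_domRestrict.1 hw').Icc_extend'
  have hWe : ∀ s ∈ Icc 0 T, W s = w' s := fun s hs => by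
    rw [hW, IccExtend_of_mem hT _ hs, domRestrict_apply]
  set g : ℝ → E := fun s => w 0 + ∫ r in (0 : ℝ)..s, W r with hg
  have hgd : ∀ s, HasDerivAt g (W s) s := fun s =>
    (hWc.integral_hasStrictDerivAt 0 s).hasDerivAt.const_add _
  have heq : ∀ s ∈ Icc 0 T, w s = g s := fun s hs => by
    rw [← sub_eq_zero]
    refine hsep _ fun i => ?_
    have hd' : ∀ r ∈ Icc 0 T, HasDerivWithinAt (fun r => L i (w r) - L i (g r)) 0 (Icc 0 T) r := by
      intro r hr
      have h2 := ((L i).hasFDerivAt.comp_hasDerivAt r (hgd r)).hasDerivWithinAt (s := Icc 0 T)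
      refine ((hd i r hr).sub h2).congr_deriv ?_
      rw [hWe r hr, sub_self]
    have h := constant_of_has_deriv_right_zero
      (fun r hr => (hd' r hr).continuousWithinAt)
      (fun r hr => (hd' r (Ico_subset_Icc_self hr)).mono_of_mem_nhdsWithin
        (Icc_mem_nhdsGE_of_mem hr)) s hs
    rw [map_sub]
    simpa [hg] using h
  rw [← hWe t ht]
  exact (hgd t).hasDerivWithinAt.congr heq (heq t ht)

lemma HasDerivWithinAt.Ici_of_Icc {w : ℝ → E} {w' : E} {t T : ℝ} (htT : t < T)
    (h : HasDerivWithinAt w w' (Icc 0 T) t) : HasDerivWithinAt w w' (Ici 0) t :=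
  h.mono_of_mem_nhdsWithin <| by
    rw [← Ici_inter_Iic]
    exact inter_mem_nhdsWithin _ (Iic_mem_nhds htT)

end ODE

/-! ### Truncation of the nonlinear force -/

/-- `g` is a globally Lipschitz force that agrees with `f` on `[-R, R]`, and `G` is its primitive,
which is still nonpositive. -/
structure IsTruncation (f : ℝ → ℝ) (R : ℝ) (g G : ℝ → ℝ) (K : ℝ≥0) : Prop where
  lipschitz : LipschitzWith K g
  map_zero : g 0 = 0
  eq_force : ∀ x, |x| ≤ R → g x = f x
  primitive_eq : ∀ x, |x| ≤ R → G x = ∫ ξ in (0 : ℝ)..x, f ξ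
  hasDerivAt : ∀ x, HasDerivAt G (g x) x
  nonpos : ∀ x, G x ≤ 0

/-- Truncations exist: if `ψ` is the primitive of a cut-off function `θ`, then
`f(ψ(x)) θ(x)` has the primitive `P(ψ(x)) ≤ 0`, where `P` is the primitive of `f`. -/
lemma exists_isTruncation {f : ℝ → ℝ} (hf : FoundationAssumption f) {R : ℝ} (hR : 0 < R) :
    ∃ g G K, IsTruncation f R g G K := by
  let θ : ContDiffBump (0 : ℝ) := ⟨R, R + 1, hR, by linarith⟩
  have hθ : ContDiff ℝ 1 θ := θ.contDiff
  have hθc : Continuous θ := θ.continuous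
  have hfc : Continuous f := hf.contDiff.continuous
  set ψ : ℝ → ℝ := fun x => ∫ y in (0 : ℝ)..x, θ y with hψ
  have hψd : ∀ x, HasDerivAt ψ (θ x) x := fun x =>
    (hθc.integral_hasStrictDerivAt 0 x).hasDerivAt
  have hψ1 : ContDiff ℝ 1 ψ := by
    rw [contDiff_one_iff_deriv]
    refine ⟨fun x => (hψd x).differentiableAt, ?_⟩
    rw [show deriv ψ = θ from funext fun x => (hψd x).deriv]
    exact hθc
  have hψe : ∀ x, |x| ≤ R → ψ x = x := by
    intro x hx
    have : ∫ y in (0 : ℝ)..x, θ y = ∫ _ in (0 : ℝ)..x, (1 : ℝ) := by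
      refine intervalIntegral.integral_congr fun y hy => ?_
      refine θ.one_of_mem_closedBall ?_
      rw [mem_closedBall_zero_iff, Real.norm_eq_abs]
      have := abs_sub_left_of_mem_uIcc hy
      simp only [sub_zero] at this
      exact this.trans hx
    simp [hψ, this]
  have hg1 : ContDiff ℝ 1 fun x => f (ψ x) * θ x := (hf.contDiff.comp hψ1).mul hθ
  have hgs : HasCompactSupport fun x => f (ψ x) * θ x := θ.hasCompactSupport.mul_left
  obtain ⟨K, hK⟩ := hg1.lipschitzWith_of_hasCompactSupport hgs one_ne_zero
  have hθ1 : ∀ x, |x| ≤ R → θ x = 1 := fun x hx =>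
    θ.one_of_mem_closedBall (by rwa [mem_closedBall_zero_iff, Real.norm_eq_abs])
  refine ⟨_, fun x => ∫ ξ in (0 : ℝ)..ψ x, f ξ, K, hK, ?_, ?_, ?_, ?_, ?_⟩
  · simp [hψ, hf.map_zero]
  · intro x hx
    rw [hψe x hx, hθ1 x hx, mul_one]
  · intro x hx
    rw [hψe x hx]
  · intro x
    exact ((hfc.integral_hasStrictDerivAt 0 (ψ x)).hasDerivAt).comp x (hψd x)
  · exact fun x => hf.primitive_nonpos _

lemma IsTruncation.primitive_zero {f : ℝ → ℝ} {R : ℝ} {g G : ℝ → ℝ} {K : ℝ≥0}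
    (h : IsTruncation f R g G K) (hR : 0 ≤ R) : G 0 = 0 := by
  rw [h.primitive_eq 0 (by simpa using hR)]; simp

/-! ### The potential energy of a Lipschitz force -/

lemma norm_sq_eq_integral (w : L2) :
    ‖w‖ ^ 2 = ∫ x in Ioo (0 : ℝ) Real.pi, w x ^ 2 := by
  rw [← real_inner_self_eq_norm_sq, L2.inner_def]
  refine integral_congr_ae (Eventually.of_forall fun x => ?_)
  simp

section Potential

variable {g G : ℝ → ℝ} {K : ℝ≥0}

/-- A primitive of a Lipschitz function has a quadratic Taylor remainder. -/
lemma abs_taylor_le (hg : LipschitzWith K g) (hG : ∀ x, HasDerivAt G (g x) x) (x k : ℝ) :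
    |G (x + k) - G x - g x * k| ≤ K * k ^ 2 := by
  have h := (convex_uIcc x (x + k)).norm_image_sub_le_of_norm_hasDerivWithin_le
    (f := fun y => G y - g x * y) (f' := fun y => g y - g x) (C := K * |k|)
    (fun y _ => ((hG y).sub ((hasDerivAt_id y).const_mul (g x) |>.congr_deriv
      (mul_one _))).hasDerivWithinAt)
    (fun y hy => by
      refine (hg.norm_sub_le y x).trans ?_
      refine mul_le_mul_of_nonneg_left ?_ K.coe_nonneg
      have := abs_sub_left_of_mem_uIcc hy
      simpa using this) left_mem_uIcc right_mem_uIcc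
  calc |G (x + k) - G x - g x * k| = ‖G (x + k) - g x * (x + k) - (G x - g x * x)‖ := by
        rw [Real.norm_eq_abs]; congr 1; ring
    _ ≤ K * |k| * ‖x + k - x‖ := h
    _ = K * k ^ 2 := by
        rw [add_sub_cancel_left, Real.norm_eq_abs, mul_assoc, abs_mul_abs_self, sq]

lemma integrable_potential (hg : LipschitzWith K g) (h0 : g 0 = 0) (hG : ∀ x, HasDerivAt G (g x) x)
    (hG0 : G 0 = 0) (w : L2) :
    Integrable (fun x => G (w x)) (volume.restrict (Ioo (0 : ℝ) Real.pi)) := by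
  have hc : Continuous G := continuous_iff_continuousAt.2 fun x => (hG x).continuousAt
  refine ((Lp.memLp w).integrable_sq.const_mul (K : ℝ)).mono'
    (hc.comp_aestronglyMeasurable (Lp.aestronglyMeasurable w)) ?_
  refine Eventually.of_forall fun x => ?_
  have := abs_taylor_le hg hG 0 (w x)
  simpa [hG0, h0] using this

/-- The potential `w ↦ ∫ G(w)` of a Lipschitz force `g` is differentiable on `L²(0, π)`, and its
gradient is the superposition operator of `g`. -/
lemma hasFDerivAt_potential (hg : LipschitzWith K g) (h0 : g 0 = 0)
    (hG : ∀ x, HasDerivAt G (g x) x) (hG0 : G 0 = 0) (w : L2) :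
    HasFDerivAt (fun w : L2 => ∫ x in Ioo (0 : ℝ) Real.pi, G (w x))
      (innerSL ℝ (hg.compLp h0 w)) w := by
  -- the Taylor remainder is quadratic pointwise, hence quadratic in the `L²` norm
  rw [hasFDerivAt_iff_isLittleO_nhds_zero]
  refine Asymptotics.IsBigO.trans_isLittleO (g := fun k : L2 => ‖k‖ ^ 2) ?_
    (Asymptotics.isLittleO_norm_pow_id one_lt_two)
  refine Asymptotics.IsBigO.of_bound (K : ℝ) (Eventually.of_forall fun k => ?_)
  have hi := integrable_potential hg h0 hG hG0
  have hin : Integrable (fun x => hg.compLp h0 w x * k x)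
      (volume.restrict (Ioo (0 : ℝ) Real.pi)) :=
    (Lp.memLp (hg.compLp h0 w)).integrable_mul (Lp.memLp k)
  have e : (∫ x in Ioo (0 : ℝ) Real.pi, G ((w + k : L2) x)) - (∫ x in Ioo (0 : ℝ) Real.pi, G (w x))
      - innerSL ℝ (hg.compLp h0 w) k =
      ∫ x in Ioo (0 : ℝ) Real.pi, (G ((w + k : L2) x) - G (w x) - hg.compLp h0 w x * k x) := by
    have e1 : innerSL ℝ (hg.compLp h0 w) k =
        ∫ x in Ioo (0 : ℝ) Real.pi, hg.compLp h0 w x * k x := by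
      rw [innerSL_apply_apply, L2.inner_def]
      refine integral_congr_ae (Eventually.of_forall fun x => ?_)
      simp [mul_comm]
    rw [e1]
    exact ((integral_sub ((hi _).sub (hi _)) hin).trans
      (congrArg (· - _) (integral_sub (hi _) (hi _)))).symm
  rw [e, Real.norm_of_nonneg (sq_nonneg ‖k‖), norm_sq_eq_integral]
  refine (norm_integral_le_of_norm_le ((Lp.memLp k).integrable_sq.const_mul (K : ℝ)) ?_).trans_eq
    (integral_const_mul _ _)
  filter_upwards [Lp.coeFn_add w k, hg.coeFn_compLp h0 w] with x h1 h2
  rw [h1, h2, Pi.add_apply]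
  exact abs_taylor_le hg hG (w x) (k x)

end Potential

/-! ### Energy coordinates -/

/-- The sign conditions on the coefficients of the beam equation. -/
structure BeamParams.Admissible (p : BeamParams) : Prop where
  α_pos : 0 < p.α
  β_nonneg : 0 ≤ p.β
  γ_nonneg : 0 ≤ p.γ
  δ_nonneg : 0 ≤ p.δ
  μ_pos : 0 < p.μ

variable {p : BeamParams}

/-- The square root of the stiffness `α k⁴ + γ` of a mode with wave number `k`. -/
def stiff (p : BeamParams) (n : ℕ) : ℝ := √(p.α * waveNum n ^ 4 + p.γ)

/-- The square root of the inertia `1 + μ k²` of a mode with wave number `k`. -/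
def inertia (p : BeamParams) (n : ℕ) : ℝ := √(1 + p.μ * waveNum n ^ 2)

/-- The damping rate of a mode. -/
def damp (p : BeamParams) (n : ℕ) : ℝ :=
  (p.β * waveNum n ^ 2 + p.δ) / (1 + p.μ * waveNum n ^ 2)

/-- The angular frequency of a mode without damping. -/
def freq (p : BeamParams) (n : ℕ) : ℝ := stiff p n / inertia p n

namespace BeamParams.Admissible

lemma sq_stiff (hp : p.Admissible) (n : ℕ) : stiff p n ^ 2 = p.α * waveNum n ^ 4 + p.γ :=
  Real.sq_sqrt (by have := hp.α_pos; have := hp.γ_nonneg; positivity)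

lemma sq_inertia (hp : p.Admissible) (n : ℕ) : inertia p n ^ 2 = 1 + p.μ * waveNum n ^ 2 :=
  Real.sq_sqrt (by have := hp.μ_pos; positivity)

lemma le_stiff (hp : p.Admissible) (n : ℕ) : √p.α * waveNum n ^ 2 ≤ stiff p n := by
  refine Real.le_sqrt_of_sq_le ?_
  rw [mul_pow, Real.sq_sqrt hp.α_pos.le]
  have := hp.γ_nonneg
  nlinarith

lemma stiff_le (hp : p.Admissible) (n : ℕ) : stiff p n ≤ √(p.α + p.γ) * waveNum n ^ 2 := by
  have h1 : 1 ≤ waveNum n ^ 4 := one_le_pow₀ (one_le_waveNum n)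
  have h2 := hp.γ_nonneg
  have h3 := hp.α_pos
  refine Real.sqrt_le_iff.2 ⟨by positivity, ?_⟩
  rw [mul_pow, Real.sq_sqrt (by positivity)]
  nlinarith

lemma stiff_pos (hp : p.Admissible) (n : ℕ) : 0 < stiff p n := by
  have h1 := waveNum_pos n
  have h2 := Real.sqrt_pos.2 hp.α_pos
  exact (by positivity : 0 < √p.α * waveNum n ^ 2).trans_le (hp.le_stiff n)

lemma one_le_inertia (hp : p.Admissible) (n : ℕ) : 1 ≤ inertia p n := by
  have := hp.μ_pos
  exact Real.one_le_sqrt.2 (by nlinarith [sq_nonneg (waveNum n)])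

lemma inertia_pos (hp : p.Admissible) (n : ℕ) : 0 < inertia p n :=
  one_pos.trans_le (hp.one_le_inertia n)

lemma le_inertia (hp : p.Admissible) (n : ℕ) : √p.μ * waveNum n ≤ inertia p n := by
  refine Real.le_sqrt_of_sq_le ?_
  rw [mul_pow, Real.sq_sqrt hp.μ_pos.le]
  linarith

lemma inertia_le (hp : p.Admissible) (n : ℕ) : inertia p n ≤ √(1 + p.μ) * waveNum n := by
  have h1 : 1 ≤ waveNum n ^ 2 := one_le_pow₀ (one_le_waveNum n)
  have h2 := waveNum_pos n
  have h3 := hp.μ_pos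
  refine Real.sqrt_le_iff.2 ⟨by positivity, ?_⟩
  rw [mul_pow, Real.sq_sqrt (by positivity)]
  nlinarith

lemma damp_nonneg (hp : p.Admissible) (n : ℕ) : 0 ≤ damp p n := by
  have := hp.β_nonneg
  have := hp.δ_nonneg
  have := hp.μ_pos
  unfold damp
  positivity

lemma damp_le (hp : p.Admissible) (n : ℕ) : damp p n ≤ (p.β + p.δ) / p.μ := by
  have h1 : 1 ≤ waveNum n ^ 2 := one_le_pow₀ (one_le_waveNum n)
  have h2 := hp.β_nonneg
  have h3 := hp.δ_nonneg
  have h4 := hp.μ_pos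
  rw [damp, div_le_div_iff₀ (by positivity) h4]
  nlinarith [mul_nonneg (mul_nonneg h3 h4.le) (sub_nonneg.2 h1)]

lemma freq_nonneg (hp : p.Admissible) (n : ℕ) : 0 ≤ freq p n :=
  div_nonneg (hp.stiff_pos n).le (hp.inertia_pos n).le

lemma waveNum_sq_div_stiff_le (hp : p.Admissible) (n : ℕ) :
    waveNum n ^ 2 / stiff p n ≤ 1 / √p.α := by
  have h := Real.sqrt_pos.2 hp.α_pos
  rw [div_le_div_iff₀ (hp.stiff_pos n) h]
  linarith [hp.le_stiff n]

lemma waveNum_div_stiff_le (hp : p.Admissible) (n : ℕ) : waveNum n / stiff p n ≤ 1 / √p.α := by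
  refine le_trans ?_ (hp.waveNum_sq_div_stiff_le n)
  have := hp.stiff_pos n
  gcongr
  nlinarith [one_le_waveNum n]

lemma one_div_stiff_le (hp : p.Admissible) (n : ℕ) : 1 / stiff p n ≤ 1 / √p.α := by
  refine le_trans ?_ (hp.waveNum_div_stiff_le n)
  have := hp.stiff_pos n
  gcongr
  exact one_le_waveNum n

lemma one_div_inertia_le (hp : p.Admissible) (n : ℕ) : 1 / inertia p n ≤ 1 := by
  rw [div_le_one (hp.inertia_pos n)]
  exact hp.one_le_inertia n

lemma waveNum_div_inertia_le (hp : p.Admissible) (n : ℕ) :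
    waveNum n / inertia p n ≤ 1 / √p.μ := by
  have h := Real.sqrt_pos.2 hp.μ_pos
  rw [div_le_div_iff₀ (hp.inertia_pos n) h]
  linarith [hp.le_inertia n]

lemma freq_div_inertia_le (hp : p.Admissible) (n : ℕ) :
    freq p n / inertia p n ≤ √(p.α + p.γ) / p.μ := by
  have h1 := hp.inertia_pos n
  have h2 := hp.μ_pos
  rw [freq, div_div, ← sq, hp.sq_inertia, div_le_div_iff₀ (by positivity) h2]
  have h3 := hp.stiff_le n
  nlinarith [Real.sqrt_nonneg (p.α + p.γ)]

end BeamParams.Admissible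

/-- The operator `(ζₙ) ↦ (cₙ Re ζₙ)`. -/
def reMul (c : ℕ → ℝ) (C : ℝ) (hc : ∀ n, |c n| ≤ C) : CSeq →L[ℝ] RSeq :=
  diagOp (fun n => c n • Complex.reCLM) C fun n => by
    rw [norm_smul, Complex.reCLM_norm, mul_one]; exact hc n

/-- The operator `(ζₙ) ↦ (cₙ Im ζₙ)`. -/
def imMul (c : ℕ → ℝ) (C : ℝ) (hc : ∀ n, |c n| ≤ C) : CSeq →L[ℝ] RSeq :=
  diagOp (fun n => c n • Complex.imCLM) C fun n => by
    rw [norm_smul, Complex.imCLM_norm, mul_one]; exact hc n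

/-- The operator `(xₙ) ↦ (i cₙ xₙ)`. -/
def mulI (c : ℕ → ℝ) (C : ℝ) (hc : ∀ n, |c n| ≤ C) : RSeq →L[ℝ] CSeq :=
  diagOp (fun n => c n • ContinuousLinearMap.toSpanSingleton ℝ Complex.I) C fun n => by
    rw [norm_smul, ContinuousLinearMap.norm_toSpanSingleton, Complex.norm_I, mul_one]; exact hc n

section

variable {c : ℕ → ℝ} {C : ℝ} {hc : ∀ n, |c n| ≤ C}

@[simp] lemma imMul_apply (ζ : CSeq) (n : ℕ) : imMul c C hc ζ n = c n * (ζ n).im := rfl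

@[simp] lemma mulI_apply (x : RSeq) (n : ℕ) :
    mulI c C hc x n = ((c n * x n : ℝ) : ℂ) * Complex.I := by
  change c n • (x n • Complex.I) = _
  rw [Complex.real_smul, Complex.real_smul]
  push_cast
  ring

end

namespace BeamParams.Admissible

/-- The sine coefficients of the displacement as a function of the energy coordinates. -/
def uSeq (hp : p.Admissible) : CSeq →L[ℝ] RSeq :=
  reMul (fun n => 1 / stiff p n) (1 / √p.α) fun n => by
    rw [abs_of_pos (one_div_pos.2 (hp.stiff_pos n))]; exact hp.one_div_stiff_le n

/-- The cosine coefficients of `u_x` as a function of the energy coordinates. -/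
def uxSeq (hp : p.Admissible) : CSeq →L[ℝ] RSeq :=
  reMul (fun n => waveNum n / stiff p n) (1 / √p.α) fun n => by
    rw [abs_of_pos (div_pos (waveNum_pos n) (hp.stiff_pos n))]; exact hp.waveNum_div_stiff_le n

/-- The sine coefficients of `u_xx` as a function of the energy coordinates. -/
def uxxSeq (hp : p.Admissible) : CSeq →L[ℝ] RSeq :=
  reMul (fun n => -(waveNum n ^ 2 / stiff p n)) (1 / √p.α) fun n => by
    have := waveNum_pos n
    rw [abs_neg, abs_of_pos (div_pos (by positivity) (hp.stiff_pos n))]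
    exact hp.waveNum_sq_div_stiff_le n

/-- The sine coefficients of the velocity as a function of the energy coordinates. -/
def vSeq (hp : p.Admissible) : CSeq →L[ℝ] RSeq :=
  imMul (fun n => 1 / inertia p n) 1 fun n => by
    rw [abs_of_pos (one_div_pos.2 (hp.inertia_pos n))]; exact hp.one_div_inertia_le n

/-- The cosine coefficients of `v_x` as a function of the energy coordinates. -/
def vxSeq (hp : p.Admissible) : CSeq →L[ℝ] RSeq :=
  imMul (fun n => waveNum n / inertia p n) (1 / √p.μ) fun n => by
    rw [abs_of_pos (div_pos (waveNum_pos n) (hp.inertia_pos n))]; exact hp.waveNum_div_inertia_le n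

lemma uSeq_apply (hp : p.Admissible) (ζ : CSeq) (n : ℕ) :
    hp.uSeq ζ n = 1 / stiff p n * (ζ n).re := rfl

lemma uxSeq_apply (hp : p.Admissible) (ζ : CSeq) (n : ℕ) :
    hp.uxSeq ζ n = waveNum n / stiff p n * (ζ n).re := rfl

lemma uxxSeq_apply (hp : p.Admissible) (ζ : CSeq) (n : ℕ) :
    hp.uxxSeq ζ n = -(waveNum n ^ 2 / stiff p n) * (ζ n).re := rfl

lemma vSeq_apply (hp : p.Admissible) (ζ : CSeq) (n : ℕ) :
    hp.vSeq ζ n = 1 / inertia p n * (ζ n).im := rfl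

lemma vxSeq_apply (hp : p.Admissible) (ζ : CSeq) (n : ℕ) :
    hp.vxSeq ζ n = waveNum n / inertia p n * (ζ n).im := rfl

/-- The displacement `u` as a function of the energy coordinates
`ζₙ = √(α k⁴ + γ) uₙ + i √(1 + μ k²) vₙ`, where `uₙ`, `vₙ` are the coefficients of `u`, `v` in the
basis of normalized sines and `k = n + 1`. -/
def uOp (hp : p.Admissible) : CSeq →L[ℝ] L2 := sinSeries.toContinuousLinearMap ∘L hp.uSeq

/-- The derivative `u_x` of the displacement as a function of the energy coordinates. -/
def uxOp (hp : p.Admissible) : CSeq →L[ℝ] L2 := cosSeries.toContinuousLinearMap ∘L hp.uxSeq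

/-- The second derivative `u_xx` of the displacement as a function of the energy coordinates. -/
def uxxOp (hp : p.Admissible) : CSeq →L[ℝ] L2 := sinSeries.toContinuousLinearMap ∘L hp.uxxSeq

/-- The velocity `v` as a function of the energy coordinates. -/
def vOp (hp : p.Admissible) : CSeq →L[ℝ] L2 := sinSeries.toContinuousLinearMap ∘L hp.vSeq

/-- The derivative `v_x` of the velocity as a function of the energy coordinates. -/
def vxOp (hp : p.Admissible) : CSeq →L[ℝ] L2 := cosSeries.toContinuousLinearMap ∘L hp.vxSeq

lemma uOp_apply (hp : p.Admissible) (ζ : CSeq) : hp.uOp ζ = sinSeries (hp.uSeq ζ) := rfl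

lemma uxOp_apply (hp : p.Admissible) (ζ : CSeq) : hp.uxOp ζ = cosSeries (hp.uxSeq ζ) := rfl

lemma uxxOp_apply (hp : p.Admissible) (ζ : CSeq) : hp.uxxOp ζ = sinSeries (hp.uxxSeq ζ) := rfl

lemma vOp_apply (hp : p.Admissible) (ζ : CSeq) : hp.vOp ζ = sinSeries (hp.vSeq ζ) := rfl

lemma vxOp_apply (hp : p.Admissible) (ζ : CSeq) : hp.vxOp ζ = cosSeries (hp.vxSeq ζ) := rfl

lemma abs_damp_le (hp : p.Admissible) (n : ℕ) : |damp p n| ≤ (p.β + p.δ) / p.μ := by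
  rw [abs_of_nonneg (hp.damp_nonneg n)]; exact hp.damp_le n

lemma abs_one_div_inertia_le (hp : p.Admissible) (n : ℕ) : |1 / inertia p n| ≤ 1 := by
  rw [abs_of_pos (one_div_pos.2 (hp.inertia_pos n))]; exact hp.one_div_inertia_le n

/-- The damping in energy coordinates. -/
def dampOp (hp : p.Admissible) : CSeq →L[ℝ] CSeq :=
  -(mulI (fun _ => 1) 1 (fun _ => by simp) ∘L imMul (damp p) ((p.β + p.δ) / p.μ) hp.abs_damp_le)

/-- The action of a load in energy coordinates. -/
def loadOp (hp : p.Admissible) : L2 →L[ℝ] CSeq :=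
  mulI (fun n => 1 / inertia p n) 1 hp.abs_one_div_inertia_le ∘L
    sineBasis.repr.toLinearIsometry.toContinuousLinearMap

lemma dampOp_apply (hp : p.Admissible) (ζ : CSeq) (n : ℕ) :
    hp.dampOp ζ n = ((-(damp p n * (ζ n).im) : ℝ) : ℂ) * Complex.I := by
  refine (congrArg Neg.neg (mulI_apply (C := 1) (hc := fun _ => by simp)
    (imMul (damp p) ((p.β + p.δ) / p.μ) hp.abs_damp_le ζ) n)).trans ?_
  rw [imMul_apply, one_mul, Complex.ofReal_neg, neg_mul]

lemma loadOp_apply (hp : p.Admissible) (w : L2) (n : ℕ) :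
    hp.loadOp w n = ((pair w (sinMode n) / inertia p n : ℝ) : ℂ) * Complex.I := by
  refine (mulI_apply (hc := hp.abs_one_div_inertia_le) (sineBasis.repr w) n).trans ?_
  rw [sineBasis_repr_apply, one_div_mul_eq_div]

lemma pair_uOp (hp : p.Admissible) (ζ : CSeq) (n : ℕ) :
    pair (hp.uOp ζ) (sinMode n) = (ζ n).re / stiff p n := by
  rw [uOp_apply, pair_sinSeries, uSeq_apply, one_div_mul_eq_div]

lemma pair_uxxOp (hp : p.Admissible) (ζ : CSeq) (n : ℕ) :
    pair (hp.uxxOp ζ) (sinMode n) = -(waveNum n ^ 2 * ((ζ n).re / stiff p n)) := by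
  rw [uxxOp_apply, pair_sinSeries, uxxSeq_apply]
  ring

lemma pair_vOp (hp : p.Admissible) (ζ : CSeq) (n : ℕ) :
    pair (hp.vOp ζ) (sinMode n) = (ζ n).im / inertia p n := by
  rw [vOp_apply, pair_sinSeries, vSeq_apply, one_div_mul_eq_div]

lemma isWeakDerivZero_uOp (hp : p.Admissible) (ζ : CSeq) :
    IsWeakDerivZero (hp.uOp ζ) (hp.uxOp ζ) := by
  rw [uOp_apply, uxOp_apply]
  exact isWeakDerivZero_sinSeries fun n => by rw [uSeq_apply, uxSeq_apply]; ring

lemma isWeakDeriv_uxOp (hp : p.Admissible) (ζ : CSeq) : IsWeakDeriv (hp.uxOp ζ) (hp.uxxOp ζ) := by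
  rw [uxOp_apply, uxxOp_apply]
  exact isWeakDeriv_cosSeries fun n => by rw [uxSeq_apply, uxxSeq_apply]; ring

lemma isWeakDerivZero_vOp (hp : p.Admissible) (ζ : CSeq) :
    IsWeakDerivZero (hp.vOp ζ) (hp.vxOp ζ) := by
  rw [vOp_apply, vxOp_apply]
  exact isWeakDerivZero_sinSeries fun n => by rw [vSeq_apply, vxSeq_apply]; ring

lemma norm_uxOp_le (hp : p.Admissible) (ζ : CSeq) : ‖hp.uxOp ζ‖ ≤ 1 / √p.α * ‖ζ‖ := by
  rw [uxOp_apply, cosSeries.norm_map]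
  unfold uxSeq reMul
  exact norm_diagOp_apply_le _

lemma norm_vOp_le (hp : p.Admissible) (ζ : CSeq) : ‖hp.vOp ζ‖ ≤ ‖ζ‖ := by
  rw [vOp_apply, sinSeries.norm_map, ← one_mul ‖ζ‖]
  unfold vSeq imMul
  exact norm_diagOp_apply_le _

lemma inner_dampOp_nonpos (hp : p.Admissible) (ζ : CSeq) : ⟪ζ, hp.dampOp ζ⟫_ℝ ≤ 0 := by
  refine (lp.hasSum_inner (𝕜 := ℝ) ζ (hp.dampOp ζ)).nonpos fun n => ?_
  rw [hp.dampOp_apply, Complex.inner]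
  simp
  nlinarith [hp.damp_nonneg n, mul_self_nonneg (ζ n).im]

lemma inner_loadOp (hp : p.Admissible) (ζ : CSeq) (w : L2) :
    ⟪ζ, hp.loadOp w⟫_ℝ = ⟪w, hp.vOp ζ⟫_ℝ := by
  rw [real_inner_comm (hp.vOp ζ) w, vOp_apply]
  refine (lp.hasSum_inner (𝕜 := ℝ) ζ (hp.loadOp w)).unique ?_
  refine (hasSum_inner_sinSeries (hp.vSeq ζ) w).congr_fun fun n => ?_
  rw [hp.loadOp_apply, Complex.inner, vSeq_apply]
  simp
  ring

/-- The domain of the beam operator is parametrized by the energy coordinates. -/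
lemma exists_energy_coordinates (hp : p.Admissible) {u₀ v₀ : L2} (h : MemDomain u₀ v₀) :
    ∃ ζ : CSeq, hp.uOp ζ = u₀ ∧ hp.vOp ζ = v₀ := by
  obtain ⟨ux, uxx, vx, hu, hux, hv⟩ := h
  obtain ⟨a, ha⟩ := exists_lp_of_summable_sq (hasSum_sq_pair_sinMode uxx).summable
  obtain ⟨b, hb⟩ := exists_lp_of_summable_sq (summable_sq_pair_cosMode vx)
  have hbd : ∀ n, |-(stiff p n / waveNum n ^ 2)| ≤ √(p.α + p.γ) := fun n => by
    have := waveNum_pos n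
    rw [abs_neg, abs_of_pos (div_pos (hp.stiff_pos n) (by positivity)), div_le_iff₀ (by positivity)]
    exact hp.stiff_le n
  have hbd' : ∀ n, |inertia p n / waveNum n| ≤ √(1 + p.μ) := fun n => by
    rw [abs_of_pos (div_pos (hp.inertia_pos n) (waveNum_pos n)), div_le_iff₀ (waveNum_pos n)]
    exact hp.inertia_le n
  let re : RSeq →L[ℝ] CSeq := diagOp (fun _ => Complex.ofRealCLM) 1 fun _ => by simp
  let D : RSeq →L[ℝ] RSeq := diagOp
    (fun n => (-(stiff p n / waveNum n ^ 2)) • ContinuousLinearMap.id ℝ ℝ) _ fun n => by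
      rw [norm_smul, ContinuousLinearMap.norm_id, mul_one]; exact hbd n
  have hζ : ∀ n, (re (D a) + mulI _ _ hbd' b : CSeq) n =
      ((-(stiff p n / waveNum n ^ 2) * a n : ℝ) : ℂ) +
        ((inertia p n / waveNum n * b n : ℝ) : ℂ) * Complex.I := fun n => by
    rw [lp.coeFn_add, Pi.add_apply, mulI_apply]; rfl
  refine ⟨re (D a) + mulI _ _ hbd' b, eq_of_pair_sinMode_eq fun n => ?_,
    eq_of_pair_sinMode_eq fun n => ?_⟩
  · rw [hp.pair_uOp, hζ, Complex.add_re, Complex.ofReal_re, Complex.re_ofReal_mul, Complex.I_re,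
      ha, hux.pair_sinMode, hu.pair_cosMode]
    have h1 := (hp.stiff_pos n).ne'
    have h2 := (waveNum_pos n).ne'
    field_simp
    ring
  · rw [hp.pair_vOp, hζ, Complex.add_im, Complex.ofReal_im, Complex.im_ofReal_mul, Complex.I_im,
      hb, hv.pair_cosMode]
    have h1 := (hp.inertia_pos n).ne'
    have h2 := (waveNum_pos n).ne'
    field_simp
    ring

end BeamParams.Admissible

/-! ### The evolution in energy coordinates -/

/-- The right-hand side of the beam equation in energy coordinates, without the skew-adjoint part:
damping and load. -/
def BeamParams.Admissible.rhs (hp : p.Admissible) (F : L2) (ζ : CSeq) : CSeq :=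
  hp.dampOp ζ + hp.loadOp F

/-- `ζ` solves, mode by mode, the beam equation in energy coordinates with load `F` on the time
set `J`. -/
structure IsModalSolution (hp : p.Admissible) (J : Set ℝ) (F : ℝ → L2) (ζ : ℝ → CSeq) : Prop where
  continuousOn : ContinuousOn ζ J
  continuousOn_load : ContinuousOn F J
  hasDeriv : ∀ t ∈ J, ∀ n, HasDerivWithinAt (fun s => ζ s n)
    (-(freq p n * Complex.I) * ζ t n + hp.rhs (F t) (ζ t) n) J t

lemma lipschitzWith_rotation (σ : ℕ → ℝ) (t : ℝ) : LipschitzWith 1 (rotation σ t) :=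
  LipschitzWith.of_dist_le_mul fun x y => by
    rw [dist_eq_norm, ← map_sub, norm_rotation, dist_eq_norm, NNReal.coe_one, one_mul]

lemma inner_rotation (σ : ℕ → ℝ) (t : ℝ) (x y : CSeq) :
    ⟪rotation σ t x, rotation σ t y⟫_ℝ = ⟪x, y⟫_ℝ :=
  LinearIsometry.inner_map_map ⟨(rotation σ t).toLinearMap, norm_rotation σ t⟩ x y

lemma rotation_neg_rotation (σ : ℕ → ℝ) (t : ℝ) (x : CSeq) :
    rotation σ (-t) (rotation σ t x) = x := by
  simpa using rotation_rotation_neg σ (-t) x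

/-- For a load that is a Lipschitz function of the displacement, the beam equation has solutions on
compact time intervals. In the frame that rotates with the undamped modes it is an ordinary
differential equation with Lipschitz right-hand side. The balance law of the energy `‖ζ‖² / 2` is
part of the statement because it is read off from the rotating frame. -/
lemma exists_isModalSolution_of_lipschitz (hp : p.Admissible) {N : L2 → L2} {K : ℝ≥0}
    (hN : LipschitzWith K N) {k : ℝ → L2} (hk : Continuous k) {T : ℝ} (hT : 0 ≤ T) (ζ₀ : CSeq) :
    ∃ ζ : ℝ → CSeq, ζ 0 = ζ₀ ∧
      IsModalSolution hp (Icc 0 T) (fun t => N (hp.uOp (ζ t)) + k t) ζ ∧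
      ∀ t ∈ Icc 0 T, HasDerivWithinAt (fun s => ‖ζ s‖ ^ 2 / 2)
        ⟪ζ t, hp.rhs (N (hp.uOp (ζ t)) + k t) (ζ t)⟫_ℝ (Icc 0 T) t := by
  set σ := freq p with hσ
  set B : ℝ → CSeq → CSeq := fun t ζ => hp.rhs (N (hp.uOp ζ) + k t) ζ with hB
  have hBc : ∀ {s : Set ℝ} {x : ℝ → CSeq}, ContinuousOn x s →
      ContinuousOn (fun t => B t (x t)) s := by
    intro s x hx
    have h1 : ContinuousOn (fun t => N (hp.uOp (x t))) s :=
      hN.continuous.comp_continuousOn (hp.uOp.continuous.comp_continuousOn hx)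
    exact (hp.dampOp.continuous.comp_continuousOn hx).add
      (hp.loadOp.continuous.comp_continuousOn (h1.add hk.continuousOn))
  have hBL : ∀ t, LipschitzWith (‖hp.dampOp‖₊ + ‖hp.loadOp‖₊ * (K * ‖hp.uOp‖₊)) (B t) := by
    intro t
    refine hp.dampOp.lipschitz.add (hp.loadOp.lipschitz.comp ?_)
    simpa using (hN.comp hp.uOp.lipschitz).add (LipschitzWith.const (k t))
  obtain ⟨η, hη0, hη⟩ := exists_hasDerivWithinAt_of_lipschitzWith hT
    (G := fun t x => rotation σ t (B t (rotation σ (-t) x)))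
    (fun t _ => (lipschitzWith_rotation σ t).comp ((hBL t).comp (lipschitzWith_rotation σ (-t))))
    (fun x => continuousOn_rotation continuous_id
      (hBc (continuousOn_rotation continuous_neg continuousOn_const))) ζ₀
  set ζ : ℝ → CSeq := fun t => rotation σ (-t) (η t) with hζ
  have hηζ : ∀ t, η t = rotation σ t (ζ t) := fun t => (rotation_rotation_neg σ t (η t)).symm
  have hζc : ContinuousOn ζ (Icc 0 T) :=
    continuousOn_rotation continuous_neg fun t ht => (hη t ht).continuousWithinAt
  -- back from the rotating frame: the product rule restores the skew-adjoint part
  refine ⟨ζ, ?_, ⟨hζc, ?_, fun t ht n => ?_⟩, fun t ht => ?_⟩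
  · change rotation σ (-0) (η 0) = ζ₀
    rw [neg_zero, rotation_zero, hη0]
  · exact (hN.continuous.comp_continuousOn (hp.uOp.continuous.comp_continuousOn hζc)).add
      hk.continuousOn
  · have h1 : HasDerivWithinAt (fun s => η s n) (rotation σ t (B t (ζ t)) n) (Icc 0 T) t :=
      (lp.evalCLM ℝ (fun _ : ℕ => ℂ) 2 n).hasFDerivAt.comp_hasDerivWithinAt t (hη t ht)
    have h2 : HasDerivAt (fun s : ℝ => Complex.exp (((σ n * (-s) : ℝ) : ℂ) * Complex.I))
        (Complex.exp (((σ n * (-t) : ℝ) : ℂ) * Complex.I) * (-(σ n * Complex.I))) t := by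
      have h3 : HasDerivAt (fun s : ℝ => ((σ n * (-s) : ℝ) : ℂ) * Complex.I)
          (-(σ n * Complex.I)) t := by
        have h4 : HasDerivAt (fun s : ℝ => σ n * (-s)) (-σ n) t := by
          simpa using (hasDerivAt_neg t).const_mul (σ n)
        refine (h4.ofReal_comp.mul_const Complex.I).congr_deriv ?_
        push_cast; ring
      exact h3.cexp
    have h5 := h2.hasDerivWithinAt.mul h1
    refine h5.congr_deriv ?_
    have h6 : Complex.exp (((σ n * (-t) : ℝ) : ℂ) * Complex.I) * rotation σ t (B t (ζ t)) n =
        B t (ζ t) n := by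
      rw [← rotation_apply, rotation_neg_rotation]
    rw [h6]
    change _ = -(σ n * Complex.I) * rotation σ (-t) (η t) n + B t (ζ t) n
    rw [rotation_apply]
    ring
  · have h1 := (hη t ht).norm_sq.div_const 2
    have h2 : (fun s => ‖η s‖ ^ 2 / 2) = fun s => ‖ζ s‖ ^ 2 / 2 := by
      ext s; rw [hηζ, norm_rotation]
    rw [h2] at h1
    refine h1.congr_deriv ?_
    change 2 * ⟪η t, rotation σ t (B t (ζ t))⟫_ℝ / 2 = _
    rw [hηζ t, inner_rotation]
    ring

namespace IsModalSolution

variable {hp : p.Admissible} {J : Set ℝ} {F : ℝ → L2} {ζ : ℝ → CSeq}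

lemma hasDerivWithinAt_re (h : IsModalSolution hp J F ζ) {t : ℝ} (ht : t ∈ J) (n : ℕ) :
    HasDerivWithinAt (fun s => (ζ s n).re) (freq p n * (ζ t n).im) J t := by
  have := Complex.reCLM.hasFDerivAt.comp_hasDerivWithinAt t (h.hasDeriv t ht n)
  refine this.congr_deriv ?_
  rw [BeamParams.Admissible.rhs, lp.coeFn_add, Pi.add_apply, hp.dampOp_apply, hp.loadOp_apply]
  simp

lemma hasDerivWithinAt_im (h : IsModalSolution hp J F ζ) {t : ℝ} (ht : t ∈ J) (n : ℕ) :
    HasDerivWithinAt (fun s => (ζ s n).im) (-(freq p n * (ζ t n).re) - damp p n * (ζ t n).im +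
      pair (F t) (sinMode n) / inertia p n) J t := by
  have := Complex.imCLM.hasFDerivAt.comp_hasDerivWithinAt t (h.hasDeriv t ht n)
  refine this.congr_deriv ?_
  rw [BeamParams.Admissible.rhs, lp.coeFn_add, Pi.add_apply, hp.dampOp_apply, hp.loadOp_apply]
  simp
  ring

lemma hasDerivWithinAt_pair_uOp (h : IsModalSolution hp J F ζ) {t : ℝ} (ht : t ∈ J) (n : ℕ) :
    HasDerivWithinAt (fun s => pair (hp.uOp (ζ s)) (sinMode n)) (pair (hp.vOp (ζ t)) (sinMode n))
      J t := by
  simp_rw [hp.pair_uOp, hp.pair_vOp]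
  refine ((h.hasDerivWithinAt_re ht n).div_const _).congr_deriv ?_
  have := (hp.stiff_pos n).ne'
  rw [freq]
  field_simp

lemma hasDerivWithinAt_pair_vOp (h : IsModalSolution hp J F ζ) {t : ℝ} (ht : t ∈ J) (n : ℕ) :
    HasDerivWithinAt (fun s => pair (hp.vOp (ζ s)) (sinMode n))
      ((-((p.α * waveNum n ^ 4 + p.γ) * pair (hp.uOp (ζ t)) (sinMode n))
        - (p.β * waveNum n ^ 2 + p.δ) * pair (hp.vOp (ζ t)) (sinMode n)
        + pair (F t) (sinMode n)) / (1 + p.μ * waveNum n ^ 2)) J t := by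
  simp_rw [hp.pair_uOp, hp.pair_vOp]
  refine ((h.hasDerivWithinAt_im ht n).div_const _).congr_deriv ?_
  have h1 := (hp.stiff_pos n).ne'
  have h2 := (hp.inertia_pos n).ne'
  rw [freq, damp, ← hp.sq_stiff, ← hp.sq_inertia]
  field_simp

end IsModalSolution

/-- The coordinate functionals of `L²(0, π)` in the sine basis. -/
def sineCoord (n : ℕ) : L2 →L[ℝ] ℝ := innerSL ℝ (sinVec n)

lemma sineCoord_apply (n : ℕ) (w : L2) : sineCoord n w = pair w (sinMode n) := by
  rw [sineCoord, innerSL_apply_apply, inner_sinVec]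

lemma eq_zero_of_sineCoord_eq_zero (w : L2) (h : ∀ n, sineCoord n w = 0) : w = 0 :=
  eq_zero_of_pair_sinMode_eq_zero fun n => by rw [← sineCoord_apply, h]

lemma IsModalSolution.hasDerivWithinAt_uOp {hp : p.Admissible} {T : ℝ} {F : ℝ → L2}
    {ζ : ℝ → CSeq} (h : IsModalSolution hp (Icc 0 T) F ζ) :
    ∀ t ∈ Icc 0 T, HasDerivWithinAt (fun s => hp.uOp (ζ s)) (hp.vOp (ζ t)) (Icc 0 T) t :=
  hasDerivWithinAt_of_coordinates sineCoord eq_zero_of_sineCoord_eq_zero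
    (w' := fun t => hp.vOp (ζ t)) (hp.vOp.continuous.comp_continuousOn h.continuousOn)
    fun n t ht => by
      simp_rw [sineCoord_apply]
      exact h.hasDerivWithinAt_pair_uOp ht n

/-! ### The a priori bound and global solutions -/

/-- The a priori bound: the energy, which controls `‖ζ‖² / 2` because the potential energy
`-∫ G(u)` is nonnegative, grows at most exponentially, at a rate that depends on the forcing only. -/
lemma energy_le_gronwallBound (hp : p.Admissible) {g G : ℝ → ℝ} {K : ℝ≥0} (hg : LipschitzWith K g)
    (h0 : g 0 = 0) (hG : ∀ x, HasDerivAt G (g x) x) (hG0 : G 0 = 0) (hGn : ∀ x, G x ≤ 0)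
    {k : ℝ → L2} {c T : ℝ} (hkc : ∀ t ∈ Icc 0 T, ‖k t‖ ^ 2 / 2 ≤ c) {ζ : ℝ → CSeq}
    (hζ : IsModalSolution hp (Icc 0 T) (fun t => hg.compLp h0 (hp.uOp (ζ t)) + k t) ζ)
    (hE : ∀ t ∈ Icc 0 T, HasDerivWithinAt (fun s => ‖ζ s‖ ^ 2 / 2)
        ⟪ζ t, hp.rhs (hg.compLp h0 (hp.uOp (ζ t)) + k t) (ζ t)⟫_ℝ (Icc 0 T) t) :
    ∀ t ∈ Icc 0 T, ‖ζ t‖ ^ 2 / 2 ≤ gronwallBound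
      (‖ζ 0‖ ^ 2 / 2 - ∫ x in Ioo (0 : ℝ) Real.pi, G (hp.uOp (ζ 0) x)) 1 c t := by
  set Φ : L2 → ℝ := fun w => ∫ x in Ioo (0 : ℝ) Real.pi, G (w x) with hΦ
  have hΦn : ∀ w, Φ w ≤ 0 := fun w => integral_nonpos fun x => hGn _
  -- the power of the elastic foundation is the rate of change of `Φ(u)`
  have hV : ∀ t ∈ Icc 0 T, HasDerivWithinAt (fun s => ‖ζ s‖ ^ 2 / 2 - Φ (hp.uOp (ζ s)))
      (⟪ζ t, hp.rhs (hg.compLp h0 (hp.uOp (ζ t)) + k t) (ζ t)⟫_ℝ -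
        ⟪hg.compLp h0 (hp.uOp (ζ t)), hp.vOp (ζ t)⟫_ℝ) (Icc 0 T) t := by
    intro t ht
    have h1 := (hasFDerivAt_potential hg h0 hG hG0 (hp.uOp (ζ t))).comp_hasDerivWithinAt t
      (hζ.hasDerivWithinAt_uOp t ht)
    exact (hE t ht).sub h1
  intro t ht
  have h := le_gronwallBound_of_liminf_deriv_right_le (δ := ‖ζ 0‖ ^ 2 / 2 - Φ (hp.uOp (ζ 0)))
    (K := 1) (ε := c) (fun s hs => (hV s hs).continuousWithinAt)
    (fun s hs r hr => ((hV s (Ico_subset_Icc_self hs)).mono_of_mem_nhdsWithin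
        (Icc_mem_nhdsGE_of_mem hs)).liminf_right_slope_le hr) le_rfl
    (fun s hs => ?_) t ht
  · rw [sub_zero] at h
    have := hΦn (hp.uOp (ζ t))
    linarith
  · have h1 := hp.inner_dampOp_nonpos (ζ s)
    have h2 := hkc s (Ico_subset_Icc_self hs)
    have h3 := hΦn (hp.uOp (ζ s))
    rw [BeamParams.Admissible.rhs, inner_add_right, hp.inner_loadOp, inner_add_left]
    have h4 : ⟪k s, hp.vOp (ζ s)⟫_ℝ ≤ ‖k s‖ ^ 2 / 2 + ‖ζ s‖ ^ 2 / 2 := by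
      have h5 := real_inner_le_norm (k s) (hp.vOp (ζ s))
      have h6 := mul_le_mul_of_nonneg_left (hp.norm_vOp_le (ζ s)) (norm_nonneg (k s))
      nlinarith [sq_nonneg (‖k s‖ - ‖ζ s‖)]
    linarith

/-- Where `|w| ≤ R`, the truncated load is the load. -/
lemma IsTruncation.coeFn_add_ae_eq_load {f g G : ℝ → ℝ} {R : ℝ} {K : ℝ≥0}
    (htr : IsTruncation f R g G K) (ε : ℝ) {w : L2}
    (hw : ∀ᵐ x ∂(volume.restrict (Ioo (0 : ℝ) Real.pi)), |w x| ≤ R) (k : L2) :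
    (htr.lipschitz.compLp htr.map_zero w + ε • k : L2)
      =ᵐ[volume.restrict (Ioo (0 : ℝ) Real.pi)] load f ε w k := by
  filter_upwards [hw, Lp.coeFn_add (htr.lipschitz.compLp htr.map_zero w) (ε • k),
    htr.lipschitz.coeFn_compLp htr.map_zero w, Lp.coeFn_smul ε k] with x h1 h2 h3 h4
  rw [h2, Pi.add_apply, h3, h4, Function.comp_apply, htr.eq_force _ h1]
  simp [load]

/-- Solutions on compact time intervals. The truncation level `R` is chosen above the a priori bound,
which does not depend on it, so the solution of the truncated equation never feels the
truncation. -/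
lemma exists_isModalSolution (hp : p.Admissible) {f : ℝ → ℝ} (hf : FoundationAssumption f)
    {h : ℝ → L2} (hh : Continuous h) (ε : ℝ) {T : ℝ} (hT : 0 ≤ T) (ζ₀ : CSeq) :
    ∃ (F : ℝ → L2) (ζ : ℝ → CSeq), ζ 0 = ζ₀ ∧ IsModalSolution hp (Icc 0 T) F ζ ∧
      ∀ t ∈ Icc 0 T, F t =ᵐ[volume.restrict (Ioo (0 : ℝ) Real.pi)]
        load f ε (hp.uOp (ζ t)) (h t) := by
  obtain ⟨S, hS0, hS⟩ := exists_sup_bound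
  have hk : Continuous fun t => ε • h t := hh.const_smul ε
  obtain ⟨c, hc⟩ := isCompact_Icc.exists_bound_of_continuousOn
    (f := fun t => ‖ε • h t‖ ^ 2 / 2) (s := Icc 0 T) (by fun_prop)
  have hc' : ∀ t ∈ Icc 0 T, ‖ε • h t‖ ^ 2 / 2 ≤ c := fun t ht => (le_abs_self _).trans (hc t ht)
  have hc0 : 0 ≤ c := (norm_nonneg _).trans (hc 0 ⟨le_rfl, hT⟩)
  -- the initial energy of the original problem; it does not involve the truncation level
  set W₀ := ‖ζ₀‖ ^ 2 / 2 -
    ∫ x in Ioo (0 : ℝ) Real.pi, (∫ ξ in (0 : ℝ)..hp.uOp ζ₀ x, f ξ) with hW₀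
  have hW₀0 : 0 ≤ W₀ := by
    have : ∫ x in Ioo (0 : ℝ) Real.pi, (∫ ξ in (0 : ℝ)..hp.uOp ζ₀ x, f ξ) ≤ 0 :=
      integral_nonpos fun x => hf.primitive_nonpos _
    have := sq_nonneg ‖ζ₀‖
    linarith
  set M := gronwallBound W₀ 1 c T with hM
  have hsup : ∀ (ζ : CSeq) (r : ℝ), ‖ζ‖ ≤ r →
      ∀ᵐ x ∂(volume.restrict (Ioo (0 : ℝ) Real.pi)), |hp.uOp ζ x| ≤ S * (1 / √p.α * r) := by
    intro ζ r hr
    filter_upwards [hS _ _ (hp.isWeakDerivZero_uOp ζ)] with x hx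
    refine hx.trans (mul_le_mul_of_nonneg_left ((hp.norm_uxOp_le ζ).trans ?_) hS0)
    gcongr
  set R := S * (1 / √p.α * max ‖ζ₀‖ √(2 * M)) + 1 with hR
  have hR0 : 0 < R := by positivity
  obtain ⟨g, G, K, htr⟩ := exists_isTruncation hf hR0
  obtain ⟨ζ, hζ0, hζ, hE⟩ := exists_isModalSolution_of_lipschitz hp
    (htr.lipschitz.lipschitzWith_compLp htr.map_zero) hk hT ζ₀
  have hstart : ∫ x in Ioo (0 : ℝ) Real.pi, G (hp.uOp (ζ 0) x) =
      ∫ x in Ioo (0 : ℝ) Real.pi, (∫ ξ in (0 : ℝ)..hp.uOp ζ₀ x, f ξ) := by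
    rw [hζ0]
    refine integral_congr_ae ?_
    filter_upwards [hsup ζ₀ _ (le_max_left _ √(2 * M))] with x hx
    exact htr.primitive_eq _ (hx.trans (by linarith))
  have hbound : ∀ t ∈ Icc 0 T, ‖ζ t‖ ≤ √(2 * M) := by
    intro t ht
    have h1 := energy_le_gronwallBound hp htr.lipschitz htr.map_zero htr.hasDerivAt
      (htr.primitive_zero hR0.le) htr.nonpos hc' hζ hE t ht
    rw [hstart, hζ0] at h1
    have h2 := gronwallBound_mono hW₀0 hc0 zero_le_one ht.2
    refine Real.le_sqrt_of_sq_le ?_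
    linarith
  refine ⟨_, ζ, hζ0, hζ, fun t ht => ?_⟩
  refine htr.coeFn_add_ae_eq_load ε ?_ (h t)
  filter_upwards [hsup (ζ t) _ ((hbound t ht).trans (le_max_right ‖ζ₀‖ _))] with x hx
  linarith

variable {f : ℝ → ℝ} {ε : ℝ} {h : ℝ → L2}

/-! ### The equations of the sine modes and uniqueness -/

/-- The map `(u, v)` is continuous into `H¹₀(0, π) × L²(0, π)` on the time set `J`, and its sine
coefficients satisfy the ordinary differential equations of the modes. This is implied by each of
the two notions of solution. -/
structure SolvesModes (p : BeamParams) (f : ℝ → ℝ) (ε : ℝ) (h : ℝ → L2) (J : Set ℝ)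
    (u v : ℝ → L2) : Prop where
  exists_weakDeriv : ∃ ux : ℝ → L2, (∀ t ∈ J, IsWeakDerivZero (u t) (ux t)) ∧ ContinuousOn ux J
  continuousOn_u : ContinuousOn u J
  continuousOn_v : ContinuousOn v J
  hasDeriv_u : ∀ t ∈ J, ∀ n, HasDerivWithinAt (fun s => pair (u s) (sinMode n))
    (pair (v t) (sinMode n)) J t
  hasDeriv_v : ∀ t ∈ J, ∀ n, HasDerivWithinAt (fun s => pair (v s) (sinMode n))
    ((-((p.α * waveNum n ^ 4 + p.γ) * pair (u t) (sinMode n))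
        - (p.β * waveNum n ^ 2 + p.δ) * pair (v t) (sinMode n)
        + pair (load f ε (u t) (h t)) (sinMode n)) / (1 + p.μ * waveNum n ^ 2)) J t

lemma SolvesModes.mono {J J' : Set ℝ} {u v : ℝ → L2} (hs : SolvesModes p f ε h J u v)
    (hJ : J' ⊆ J) : SolvesModes p f ε h J' u v where
  exists_weakDeriv := by
    obtain ⟨ux, h1, h2⟩ := hs.exists_weakDeriv
    exact ⟨ux, fun t ht => h1 t (hJ ht), h2.mono hJ⟩
  continuousOn_u := hs.continuousOn_u.mono hJ
  continuousOn_v := hs.continuousOn_v.mono hJ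
  hasDeriv_u := fun t ht n => (hs.hasDeriv_u t (hJ ht) n).mono hJ
  hasDeriv_v := fun t ht n => (hs.hasDeriv_v t (hJ ht) n).mono hJ

lemma IsModalSolution.solvesModes {hp : p.Admissible} {J : Set ℝ} {F : ℝ → L2} {ζ : ℝ → CSeq}
    (hζ : IsModalSolution hp J F ζ)
    (hF : ∀ t ∈ J, F t =ᵐ[volume.restrict (Ioo (0 : ℝ) Real.pi)]
        load f ε (hp.uOp (ζ t)) (h t)) :
    SolvesModes p f ε h J (fun t => hp.uOp (ζ t)) (fun t => hp.vOp (ζ t)) where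
  exists_weakDeriv := ⟨fun t => hp.uxOp (ζ t), fun t _ => hp.isWeakDerivZero_uOp _,
    hp.uxOp.continuous.comp_continuousOn hζ.continuousOn⟩
  continuousOn_u := hp.uOp.continuous.comp_continuousOn hζ.continuousOn
  continuousOn_v := hp.vOp.continuous.comp_continuousOn hζ.continuousOn
  hasDeriv_u := fun t ht n => hζ.hasDerivWithinAt_pair_uOp ht n
  hasDeriv_v := fun t ht n => by
    rw [← pair_congr (hF t ht)]
    exact hζ.hasDerivWithinAt_pair_vOp ht n

/-- A continuous curve in `H¹₀(0, π)` is uniformly bounded on compact time intervals. -/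
lemma exists_sup_bound_of_continuousOn {u ux : ℝ → L2} {T : ℝ}
    (hux : ∀ t ∈ Icc 0 T, IsWeakDerivZero (u t) (ux t)) (hc : ContinuousOn ux (Icc 0 T)) :
    ∃ R, ∀ t ∈ Icc 0 T, ∀ᵐ x ∂(volume.restrict (Ioo (0 : ℝ) Real.pi)), |u t x| ≤ R := by
  obtain ⟨S, hS0, hS⟩ := exists_sup_bound
  obtain ⟨C, hC⟩ := isCompact_Icc.exists_bound_of_continuousOn hc
  refine ⟨S * C, fun t ht => ?_⟩
  filter_upwards [hS _ _ (hux t ht)] with x hx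
  exact hx.trans (mul_le_mul_of_nonneg_left (hC t ht) hS0)

/-- Along a continuous curve in `H¹₀(0, π)` the load is a continuous curve in `L²(0, π)`. -/
lemma exists_continuousOn_load (hf : FoundationAssumption f) (hh : Continuous h) (ε : ℝ)
    {u ux : ℝ → L2} {T : ℝ} (hu : ContinuousOn u (Icc 0 T))
    (hux : ∀ t ∈ Icc 0 T, IsWeakDerivZero (u t) (ux t)) (hc : ContinuousOn ux (Icc 0 T)) :
    ∃ F : ℝ → L2, ContinuousOn F (Icc 0 T) ∧ ∀ t ∈ Icc 0 T,
      F t =ᵐ[volume.restrict (Ioo (0 : ℝ) Real.pi)] load f ε (u t) (h t) := by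
  obtain ⟨R, hR⟩ := exists_sup_bound_of_continuousOn hux hc
  obtain ⟨g, G, K, htr⟩ := exists_isTruncation hf (R := max R 1) (by positivity)
  refine ⟨fun t => htr.lipschitz.compLp htr.map_zero (u t) + ε • h t, ?_, fun t ht => ?_⟩
  · exact ((htr.lipschitz.continuous_compLp htr.map_zero).comp_continuousOn hu).add
      (hh.const_smul ε).continuousOn
  · refine htr.coeFn_add_ae_eq_load ε ?_ (h t)
    filter_upwards [hR t ht] with x hx using hx.trans (le_max_left _ _)

lemma sum_sq_sineCoord_le (w : L2) (s : Finset ℕ) : ∑ n ∈ s, sineCoord n w ^ 2 ≤ ‖w‖ ^ 2 := by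
  simpa only [sineCoord_apply] using sum_sq_pair_sinMode_le w s

lemma hasSum_sq_sineCoord (w : L2) : HasSum (fun n => sineCoord n w ^ 2) (‖w‖ ^ 2) := by
  simpa only [sineCoord_apply] using hasSum_sq_pair_sinMode w

lemma le_stiffness_ratio (hp : p.Admissible) (n : ℕ) :
    p.α / (1 + p.μ) ≤ (p.α * waveNum n ^ 4 + p.γ) / (1 + p.μ * waveNum n ^ 2) := by
  have h1 : 1 ≤ waveNum n ^ 2 := one_le_pow₀ (one_le_waveNum n)
  have h2 := hp.α_pos
  have h3 := hp.γ_nonneg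
  have h4 := hp.μ_pos
  rw [div_le_div_iff₀ (by positivity) (by positivity)]
  have h5 : waveNum n ^ 4 = waveNum n ^ 2 * waveNum n ^ 2 := by ring
  rw [h5]
  set q := waveNum n ^ 2
  have h6 : 1 + p.μ * q ≤ q * q * (1 + p.μ) := by nlinarith [mul_nonneg h4.le (sub_nonneg.2 h1)]
  nlinarith [mul_le_mul_of_nonneg_left h6 h2.le, mul_nonneg h3 h4.le]

/-- Two solutions of the mode equations with the same initial value coincide. The energies of the
modes of the difference, measured in the norm of `H¹₀ × L²`, are summed up; the difference of the
loads is controlled because both solutions are bounded. -/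
lemma SolvesModes.unique (hp : p.Admissible) (hf : FoundationAssumption f) {T : ℝ}
    {u v u' v' : ℝ → L2} (hs : SolvesModes p f ε h (Icc 0 T) u v)
    (hs' : SolvesModes p f ε h (Icc 0 T) u' v') (hu0 : u 0 = u' 0) (hv0 : v 0 = v' 0) :
    ∀ t ∈ Icc 0 T, u t = u' t ∧ v t = v' t := by
  intro t₁ ht₁
  have hT : 0 ≤ T := ht₁.1.trans ht₁.2
  obtain ⟨ux, hux, huxc⟩ := hs.exists_weakDeriv
  obtain ⟨ux', hux', huxc'⟩ := hs'.exists_weakDeriv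
  obtain ⟨R, hR⟩ := exists_sup_bound_of_continuousOn hux huxc
  obtain ⟨R', hR'⟩ := exists_sup_bound_of_continuousOn hux' huxc'
  obtain ⟨g, G, K, htr⟩ := exists_isTruncation hf (R := max (max R R') 1) (by positivity)
  set N : L2 → L2 := htr.lipschitz.compLp htr.map_zero with hN
  have hload : ∀ t ∈ Icc 0 T, ∀ n, pair (load f ε (u t) (h t)) (sinMode n) =
      sineCoord n (N (u t) + ε • h t) := by
    intro t ht n
    rw [sineCoord_apply]
    refine (pair_congr (htr.coeFn_add_ae_eq_load ε ?_ (h t))).symm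
    filter_upwards [hR t ht] with x hx using hx.trans ((le_max_left _ _).trans (le_max_left _ _))
  have hload' : ∀ t ∈ Icc 0 T, ∀ n, pair (load f ε (u' t) (h t)) (sinMode n) =
      sineCoord n (N (u' t) + ε • h t) := by
    intro t ht n
    rw [sineCoord_apply]
    refine (pair_congr (htr.coeFn_add_ae_eq_load ε ?_ (h t))).symm
    filter_upwards [hR' t ht] with x hx using hx.trans ((le_max_right _ _).trans (le_max_left _ _))
  set du : ℝ → L2 := fun t => u t - u' t with hdu
  set dv : ℝ → L2 := fun t => v t - v' t with hdv
  set dF : ℝ → L2 := fun t => N (u t) - N (u' t) with hdF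
  set I : ℕ → ℝ := fun n => 1 + p.μ * waveNum n ^ 2 with hI
  have hI1 : ∀ n, 1 ≤ I n := fun n => by
    have := hp.μ_pos
    simp only [hI]
    nlinarith [sq_nonneg (waveNum n)]
  set κ : ℕ → ℝ := fun n => (p.α * waveNum n ^ 4 + p.γ) / I n with hκ
  have hda : ∀ t ∈ Icc 0 T, ∀ n, HasDerivWithinAt (fun s => sineCoord n (du s))
      (sineCoord n (dv t)) (Icc 0 T) t := by
    intro t ht n
    simp only [hdu, hdv, map_sub, sineCoord_apply]
    exact (hs.hasDeriv_u t ht n).sub (hs'.hasDeriv_u t ht n)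
  have hdb : ∀ t ∈ Icc 0 T, ∀ n, HasDerivWithinAt (fun s => sineCoord n (dv s))
      (-(κ n * sineCoord n (du t)) - damp p n * sineCoord n (dv t) + sineCoord n (dF t) / I n)
      (Icc 0 T) t := by
    intro t ht n
    have := (hs.hasDeriv_v t ht n).sub (hs'.hasDeriv_v t ht n)
    rw [hload t ht, hload' t ht] at this
    simp only [hdu, hdv, hdF, map_sub, sineCoord_apply]
    refine this.congr_deriv ?_
    rw [map_add, map_add, sineCoord_apply, sineCoord_apply, sineCoord_apply, damp]
    simp only [hκ, hI]
    ring
  -- finite sums of mode energies can be differentiated; the estimate is uniform in their length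
  set Q : ℕ → ℝ → ℝ := fun m s => ∑ n ∈ Finset.range m,
    (κ n * sineCoord n (du s) ^ 2 + sineCoord n (dv s) ^ 2) with hQ
  have hQd : ∀ m, ∀ t ∈ Icc 0 T, HasDerivWithinAt (Q m) (∑ n ∈ Finset.range m,
      (-(2 * damp p n * sineCoord n (dv t) ^ 2) +
        2 * sineCoord n (dv t) * (sineCoord n (dF t) / I n))) (Icc 0 T) t := by
    intro m t ht
    refine HasDerivWithinAt.fun_sum fun n _ => ?_
    refine ((((hda t ht n).pow 2).const_mul (κ n)).add ((hdb t ht n).pow 2)).congr_deriv ?_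
    simp
    ring
  set D : ℝ → ℝ := fun t => ‖du t‖ ^ 2 + ‖dv t‖ ^ 2 with hD
  have hQle : ∀ m, ∀ t ∈ Icc 0 T, ∑ n ∈ Finset.range m,
      (-(2 * damp p n * sineCoord n (dv t) ^ 2) +
        2 * sineCoord n (dv t) * (sineCoord n (dF t) / I n)) ≤ (1 + K ^ 2) * D t := by
    intro m t ht
    calc _ ≤ ∑ n ∈ Finset.range m, (sineCoord n (dv t) ^ 2 + sineCoord n (dF t) ^ 2) := by
          refine Finset.sum_le_sum fun n _ => ?_
          have h1 : (sineCoord n (dF t) / I n) ^ 2 ≤ sineCoord n (dF t) ^ 2 := by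
            rw [div_pow]
            exact div_le_self (sq_nonneg _) (one_le_pow₀ (hI1 n))
          have h2 := mul_nonneg (hp.damp_nonneg n) (sq_nonneg (sineCoord n (dv t)))
          nlinarith [sq_nonneg (sineCoord n (dv t) - sineCoord n (dF t) / I n)]
      _ ≤ ‖dv t‖ ^ 2 + ‖dF t‖ ^ 2 := by
          rw [Finset.sum_add_distrib]
          exact add_le_add (sum_sq_sineCoord_le _ _) (sum_sq_sineCoord_le _ _)
      _ ≤ (1 + K ^ 2) * D t := by
          have h1 : ‖dF t‖ ≤ K * ‖du t‖ := htr.lipschitz.norm_compLp_sub_le htr.map_zero _ _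
          have h2 : ‖dF t‖ ^ 2 ≤ K ^ 2 * ‖du t‖ ^ 2 := by
            rw [← mul_pow]; exact pow_le_pow_left₀ (norm_nonneg _) h1 2
          simp only [hD]
          nlinarith [sq_nonneg ‖du t‖, mul_nonneg (sq_nonneg (K : ℝ)) (sq_nonneg ‖dv t‖)]
  have hDc : ContinuousOn D (Icc 0 T) :=
    (((hs.continuousOn_u.sub hs'.continuousOn_u).norm).pow 2).add
      (((hs.continuousOn_v.sub hs'.continuousOn_v).norm).pow 2)
  -- the integrand, extended continuously to the whole time axis
  set W := IccExtend hT ((Icc 0 T).domRestrict D) with hW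
  have hWc : Continuous W := (continuousOn_iff_continuous_domRestrict.1 hDc).Icc_extend'
  have hWe : ∀ s ∈ Icc 0 T, W s = D s := fun s hs => by
    rw [hW, IccExtend_of_mem hT _ hs, domRestrict_apply]
  set P : ℝ → ℝ := fun s => ∫ r in (0 : ℝ)..s, W r with hP
  have hPd : ∀ s, HasDerivAt P (W s) s := fun s => (hWc.integral_hasStrictDerivAt 0 s).hasDerivAt
  have hQP : ∀ m, ∀ t ∈ Icc 0 T, Q m t ≤ (1 + K ^ 2) * P t := by
    intro m t ht
    refine image_le_of_deriv_right_le_deriv_boundary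
      (fun s hs => (hQd m s hs).continuousWithinAt)
      (fun s hs => (hQd m s (Ico_subset_Icc_self hs)).mono_of_mem_nhdsWithin
        (Icc_mem_nhdsGE_of_mem hs))
      ?_ (B := fun s => (1 + K ^ 2) * P s) (B' := fun s => (1 + K ^ 2) * W s) ?_
      (fun s _ => ((hPd s).const_mul _).hasDerivWithinAt) ?_ ht
    · simp [hQ, hP, hdu, hdv, hu0, hv0]
    · exact fun s _ => ((hPd s).const_mul _).continuousAt.continuousWithinAt
    · intro s hs
      rw [hWe s (Ico_subset_Icc_self hs)]
      exact hQle m s (Ico_subset_Icc_self hs)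
  set κ₀ := min (p.α / (1 + p.μ)) 1 with hκ₀
  have hκ₀0 : 0 < κ₀ := lt_min (div_pos hp.α_pos (by linarith [hp.μ_pos])) one_pos
  -- by Parseval's identity the mode energies control the squared distance `D`
  have hDP : ∀ t ∈ Icc 0 T, D t ≤ (1 + K ^ 2) / κ₀ * P t := by
    intro t ht
    have hlim := ((hasSum_sq_sineCoord (du t)).add (hasSum_sq_sineCoord (dv t))).tendsto_sum_nat
    refine le_of_tendsto hlim (Eventually.of_forall fun m => ?_)
    rw [div_mul_eq_mul_div, le_div_iff₀ hκ₀0]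
    refine le_trans ?_ (hQP m t ht)
    rw [Finset.sum_mul]
    refine Finset.sum_le_sum fun n _ => ?_
    have h1 : κ₀ ≤ κ n := (min_le_left _ _).trans (le_stiffness_ratio hp n)
    have h2 : κ₀ ≤ 1 := min_le_right _ _
    nlinarith [sq_nonneg (sineCoord n (du t)), sq_nonneg (sineCoord n (dv t))]
  have hP0 := eq_zero_of_abs_deriv_le_mul_abs_self_of_eq_zero_right (f := P) (f' := W)
    (K := (1 + K ^ 2) / κ₀) (a := 0) (b := T) (fun s _ => (hPd s).continuousAt.continuousWithinAt)
    (fun s _ => (hPd s).hasDerivWithinAt) (by simp [hP]) (fun s hs => by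
      have hs' := Ico_subset_Icc_self hs
      have hD0 : 0 ≤ D s := by positivity
      rw [hWe s hs', Real.norm_of_nonneg hD0]
      refine (hDP s hs').trans ?_
      gcongr
      exact le_abs_self _) t₁ ht₁
  have hD0 := hDP t₁ ht₁
  rw [hP0, mul_zero] at hD0
  have h1 : ‖du t₁‖ ^ 2 = 0 := by nlinarith [sq_nonneg ‖du t₁‖, sq_nonneg ‖dv t₁‖]
  have h2 : ‖dv t₁‖ ^ 2 = 0 := by nlinarith [sq_nonneg ‖du t₁‖, sq_nonneg ‖dv t₁‖]
  exact ⟨sub_eq_zero.1 (norm_eq_zero.1 (pow_eq_zero_iff two_ne_zero |>.1 h1)),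
    sub_eq_zero.1 (norm_eq_zero.1 (pow_eq_zero_iff two_ne_zero |>.1 h2))⟩

/-- Testing the equation with a sine yields the equation of the corresponding mode. -/
lemma IsClassicalSolution.solvesModes (hp : p.Admissible) {J : Set ℝ} {u v : ℝ → L2}
    (hs : IsClassicalSolution p f ε h J u v) : SolvesModes p f ε h J u v := by
  obtain ⟨ux, uxx, vx, a, hdom, hdu, hvc, -, hdv, -, heq⟩ := hs
  refine ⟨⟨ux, fun t ht => (hdom t ht).1, fun t ht => (hdu t ht).2.continuousWithinAt⟩,
    fun t ht => (hdu t ht).1.continuousWithinAt, hvc, fun t ht n => ?_, fun t ht n => ?_⟩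
  · simp_rw [← sineCoord_apply]
    exact (sineCoord n).hasFDerivAt.comp_hasDerivWithinAt t (hdu t ht).1
  · have h1 : HasDerivWithinAt (fun s => sineCoord n (v s)) (sineCoord n (a t)) J t :=
      (sineCoord n).hasFDerivAt.comp_hasDerivWithinAt t (hdv t ht)
    simp_rw [sineCoord_apply] at h1
    refine h1.congr_deriv ?_
    have h2 := heq t ht (sinMode n) (contDiff_sinMode n) (sinMode_zero n) (sinMode_pi n)
    have e1 : deriv (sinMode n) = fun x => waveNum n * cosMode n x := deriv_sinMode n
    have e2 : deriv (deriv (sinMode n)) = fun x => -(waveNum n ^ 2) * sinMode n x := by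
      rw [e1]
      ext x
      rw [((hasDerivAt_cosMode n x).const_mul (waveNum n)).deriv]
      ring
    rw [e2, e1, pair_const_mul, pair_const_mul, pair_const_mul, (hdom t ht).2.2.pair_cosMode,
      (hdom t ht).2.1.pair_sinMode, (hdom t ht).1.pair_cosMode] at h2
    have h3 : 0 < 1 + p.μ * waveNum n ^ 2 := by have := hp.μ_pos; positivity
    rw [eq_div_iff h3.ne']
    linear_combination h2

/-! ### Variation of constants -/

section Duhamel

variable (A : Matrix (Fin 2) (Fin 2) ℝ)

open scoped Matrix.Norms.Operator in
lemma hasDerivAt_exp_smul_matrix (t : ℝ) :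
    HasDerivAt (fun s : ℝ => NormedSpace.exp (s • A)) (A * NormedSpace.exp (t • A)) t :=
  hasDerivAt_exp_smul_const' A t

lemma hasDerivAt_exp_smul_entry (t : ℝ) (i j : Fin 2) :
    HasDerivAt (fun s : ℝ => NormedSpace.exp (s • A) i j) ((A * NormedSpace.exp (t • A)) i j) t :=
  hasDerivAt_pi.1 (hasDerivAt_pi.1 (hasDerivAt_exp_smul_matrix A t) i) j

lemma exp_smul_mul_neg (t : ℝ) :
    NormedSpace.exp (t • A) * NormedSpace.exp ((-t) • A) = 1 := by
  rw [← Matrix.exp_add_of_commute _ _ ((Commute.refl A).smul_left _ |>.smul_right _), ← add_smul]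
  simp

lemma exp_sub_smul (t s : ℝ) :
    NormedSpace.exp ((t - s) • A) = NormedSpace.exp (t • A) * NormedSpace.exp ((-s) • A) := by
  rw [← Matrix.exp_add_of_commute _ _ ((Commute.refl A).smul_left _ |>.smul_right _), ← add_smul,
    sub_eq_add_neg]

lemma HasDerivWithinAt.exp_smul_mulVec {w : ℝ → Fin 2 → ℝ} {w' : Fin 2 → ℝ} {J : Set ℝ} {t : ℝ}
    (hw : HasDerivWithinAt w w' J t) :
    HasDerivWithinAt (fun s => (NormedSpace.exp (s • A)).mulVec (w s))
      (A.mulVec ((NormedSpace.exp (t • A)).mulVec (w t)) +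
        (NormedSpace.exp (t • A)).mulVec w') J t := by
  rw [hasDerivWithinAt_pi] at hw ⊢
  intro i
  have h := HasDerivWithinAt.fun_sum (u := Finset.univ) fun j _ =>
    ((hasDerivAt_exp_smul_entry A t i j).hasDerivWithinAt (s := J)).mul (hw j)
  refine h.congr_deriv ?_
  rw [Matrix.mulVec_mulVec, Pi.add_apply, Finset.sum_add_distrib]
  rfl

lemma continuous_exp_neg_smul_mulVec {G : ℝ → Fin 2 → ℝ} (hG : Continuous G) :
    Continuous fun s : ℝ => (NormedSpace.exp ((-s) • A)).mulVec (G s) := by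
  refine continuous_pi fun i => ?_
  change Continuous fun s : ℝ => ∑ j, NormedSpace.exp ((-s) • A) i j * G s j
  refine continuous_finsetSum _ fun j _ => ?_
  have h1 : Continuous fun s : ℝ => NormedSpace.exp (s • A) i j :=
    continuous_iff_continuousAt.2 fun s => (hasDerivAt_exp_smul_entry A s i j).continuousAt
  exact (h1.comp continuous_neg).mul ((continuous_apply j).comp hG)

/-- The variation of constants formula solves the inhomogeneous linear equation. -/
lemma hasDerivWithinAt_of_duhamel {x G : ℝ → Fin 2 → ℝ} {T : ℝ} (hG : ContinuousOn G (Icc 0 T))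
    (hx : ∀ t ∈ Icc 0 T, x t = (NormedSpace.exp (t • A)).mulVec (x 0) +
      ∫ s in (0 : ℝ)..t, (NormedSpace.exp ((t - s) • A)).mulVec (G s)) :
    ∀ t ∈ Icc 0 T, HasDerivWithinAt x (A.mulVec (x t) + G t) (Icc 0 T) t := by
  intro t ht
  have hT : 0 ≤ T := ht.1.trans ht.2
  -- the integrand, extended continuously to the whole time axis
  set W := IccExtend hT ((Icc 0 T).domRestrict G) with hW
  have hWc : Continuous W := (continuousOn_iff_continuous_domRestrict.1 hG).Icc_extend'
  have hWe : ∀ s ∈ Icc 0 T, W s = G s := fun s hs => by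
    rw [hW, IccExtend_of_mem hT _ hs, domRestrict_apply]
  set w : ℝ → Fin 2 → ℝ := fun s =>
    x 0 + ∫ r in (0 : ℝ)..s, (NormedSpace.exp ((-r) • A)).mulVec (W r) with hw
  have hwd : ∀ s, HasDerivAt w ((NormedSpace.exp ((-s) • A)).mulVec (W s)) s := fun s =>
    ((continuous_exp_neg_smul_mulVec A hWc).integral_hasStrictDerivAt 0 s).hasDerivAt.const_add _
  have hxw : ∀ s ∈ Icc 0 T, x s = (NormedSpace.exp (s • A)).mulVec (w s) := by
    intro s hs
    rw [hx s hs, hw, Matrix.mulVec_add]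
    congr 1
    have h1 := ContinuousLinearMap.intervalIntegral_comp_comm
      (Matrix.mulVecLin (NormedSpace.exp (s • A))).toContinuousLinearMap
      ((continuous_exp_neg_smul_mulVec A hWc).intervalIntegrable (μ := volume) 0 s)
    refine Eq.trans ?_ h1
    refine intervalIntegral.integral_congr fun r hr => ?_
    rw [uIcc_of_le hs.1] at hr
    simp only [LinearMap.coe_toContinuousLinearMap', Matrix.mulVecLin_apply]
    rw [exp_sub_smul, hWe r ⟨hr.1, hr.2.trans hs.2⟩, Matrix.mulVec_mulVec]
  have h2 := HasDerivWithinAt.exp_smul_mulVec A ((hwd t).hasDerivWithinAt (s := Icc 0 T))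
  refine (h2.congr hxw (hxw t ht)).congr_deriv ?_
  rw [← hxw t ht, Matrix.mulVec_mulVec, exp_smul_mul_neg, Matrix.one_mulVec, hWe t ht]

/-- Solutions of the inhomogeneous linear equation are given by the variation of constants
formula. -/
lemma duhamel_of_hasDerivWithinAt {x G : ℝ → Fin 2 → ℝ} {T : ℝ} (hT : 0 ≤ T)
    (hG : ContinuousOn G (Icc 0 T))
    (hx : ∀ t ∈ Icc 0 T, HasDerivWithinAt x (A.mulVec (x t) + G t) (Icc 0 T) t) :
    x T = (NormedSpace.exp (T • A)).mulVec (x 0) +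
      ∫ s in (0 : ℝ)..T, (NormedSpace.exp ((T - s) • A)).mulVec (G s) := by
  set y : ℝ → Fin 2 → ℝ := fun t => (NormedSpace.exp (t • A)).mulVec (x 0) +
      ∫ s in (0 : ℝ)..t, (NormedSpace.exp ((t - s) • A)).mulVec (G s) with hy
  have hy0 : y 0 = x 0 := by
    simp only [hy, zero_smul, NormedSpace.exp_zero, Matrix.one_mulVec,
      intervalIntegral.integral_same, add_zero]
  have hyd := hasDerivWithinAt_of_duhamel A (x := y) hG fun t _ => by rw [hy0]
  have hd : ∀ t ∈ Icc 0 T, HasDerivWithinAt (fun s => x s - y s) (A.mulVec (x t - y t))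
      (Icc 0 T) t := fun t ht => by
    refine ((hx t ht).sub (hyd t ht)).congr_deriv ?_
    rw [Matrix.mulVec_sub]; abel
  have h := eq_zero_of_abs_deriv_le_mul_abs_self_of_eq_zero_right
    (K := ‖(Matrix.mulVecLin A).toContinuousLinearMap‖)
    (fun t ht => (hd t ht).continuousWithinAt)
    (fun t ht => (hd t (Ico_subset_Icc_self ht)).mono_of_mem_nhdsWithin
      (Icc_mem_nhdsGE_of_mem ht)) (by rw [hy0, sub_self])
    (fun t _ => (Matrix.mulVecLin A).toContinuousLinearMap.le_opNorm (x t - y t)) T ⟨hT, le_rfl⟩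
  exact sub_eq_zero.1 h

end Duhamel

lemma sineCoeff_succ (n : ℕ) (w : ℝ → ℝ) :
    sineCoeff (n + 1) w = √(2 / Real.pi) * pair w (sinMode n) := by
  have h1 : pair w (sinMode n) =
      √(2 / Real.pi) * pair w fun x => Real.sin (((n + 1 : ℕ) : ℝ) * x) := by
    rw [← pair_const_mul]
    congr 1
    ext x
    simp [sinMode, waveNum]
  rw [h1, ← mul_assoc, sq_sqrt_two_div_pi, sineCoeff]

/-- The vector of the two sine coefficients of `(u, v)` with wave number `n + 1`. -/
def modeVec (n : ℕ) (u v : ℝ → L2) (t : ℝ) : Fin 2 → ℝ :=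
  ![sineCoeff (n + 1) (u t), sineCoeff (n + 1) (v t)]

/-- The inhomogeneity in the equation of the sine coefficients with wave number `n + 1`. -/
def modeLoad (p : BeamParams) (f : ℝ → ℝ) (ε : ℝ) (h : ℝ → L2) (n : ℕ) (u : ℝ → L2) (t : ℝ) :
    Fin 2 → ℝ :=
  ![0, sineCoeff (n + 1) (load f ε (u t) (h t)) / (1 + p.μ * ((n + 1 : ℕ) : ℝ) ^ 2)]

lemma hasDerivWithinAt_modeVec_iff {n : ℕ} {u v : ℝ → L2} {J : Set ℝ} {t : ℝ} :
    HasDerivWithinAt (modeVec n u v)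
      ((modeMatrix p (n + 1)).mulVec (modeVec n u v t) + modeLoad p f ε h n u t) J t ↔
    HasDerivWithinAt (fun s => pair (u s) (sinMode n)) (pair (v t) (sinMode n)) J t ∧
    HasDerivWithinAt (fun s => pair (v s) (sinMode n))
      ((-((p.α * waveNum n ^ 4 + p.γ) * pair (u t) (sinMode n))
        - (p.β * waveNum n ^ 2 + p.δ) * pair (v t) (sinMode n)
        + pair (load f ε (u t) (h t)) (sinMode n)) / (1 + p.μ * waveNum n ^ 2)) J t := by
  have hc : √(2 / Real.pi) ≠ 0 := by positivity
  have hk : ((n + 1 : ℕ) : ℝ) = waveNum n := by simp [waveNum]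
  have key : ∀ {c : ℝ} (_ : c ≠ 0) (w : ℝ → ℝ) (d : ℝ),
      HasDerivWithinAt (fun s => c * w s) (c * d) J t ↔ HasDerivWithinAt w d J t := fun {c} hc w d =>
    ⟨fun H => by simpa [hc] using H.const_mul c⁻¹, fun H => H.const_mul _⟩
  rw [hasDerivWithinAt_pi, Fin.forall_fin_two, ← key hc (fun s => pair (u s) (sinMode n)),
    ← key hc (fun s => pair (v s) (sinMode n))]
  refine and_congr (iff_of_eq ?_) (iff_of_eq ?_)
  · congr 1
    · ext s; simp [modeVec, sineCoeff_succ]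
    · simp [modeMatrix, modeVec, modeLoad, sineCoeff_succ]
  · congr 1
    · ext s; simp [modeVec, sineCoeff_succ]
    · simp only [modeMatrix, modeVec, modeLoad, sineCoeff_succ, Matrix.mulVec, dotProduct, hk,
        Pi.add_apply, Fin.sum_univ_two, Matrix.of_apply, Matrix.cons_val_zero, Matrix.cons_val_one]
      ring

lemma continuousOn_modeLoad (hf : FoundationAssumption f) (hh : Continuous h) (n : ℕ)
    {u ux : ℝ → L2} {T : ℝ} (hu : ContinuousOn u (Icc 0 T))
    (hux : ∀ t ∈ Icc 0 T, IsWeakDerivZero (u t) (ux t)) (hc : ContinuousOn ux (Icc 0 T)) :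
    ContinuousOn (modeLoad p f ε h n u) (Icc 0 T) := by
  obtain ⟨F, hF, hFe⟩ := exists_continuousOn_load hf hh ε hu hux hc
  refine continuousOn_pi.2 fun i => ?_
  fin_cases i
  · exact continuousOn_const
  · have h1 : ContinuousOn (fun t => √(2 / Real.pi) * sineCoord n (F t) /
        (1 + p.μ * ((n + 1 : ℕ) : ℝ) ^ 2)) (Icc 0 T) :=
      (((sineCoord n).continuous.comp_continuousOn hF).const_mul _).div_const _
    refine h1.congr fun t ht => ?_
    simp only
    rw [sineCoord_apply, pair_congr (hFe t ht), ← sineCoeff_succ]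
    rfl

/-- A mild solution satisfies the equations of the modes on compact time intervals. -/
lemma IsMildSolution.solvesModes (hf : FoundationAssumption f) (hh : Continuous h) {J : Set ℝ}
    {u v : ℝ → L2} (hs : IsMildSolution p f ε h J u v) {T : ℝ} (hJ : Icc 0 T ⊆ J) :
    SolvesModes p f ε h (Icc 0 T) u v := by
  obtain ⟨⟨ux, hux, huxc⟩, hu, hv, heq⟩ := hs
  have key : ∀ n, ∀ t ∈ Icc 0 T, HasDerivWithinAt (modeVec n u v)
      ((modeMatrix p (n + 1)).mulVec (modeVec n u v t) + modeLoad p f ε h n u t) (Icc 0 T) t :=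
    fun n => hasDerivWithinAt_of_duhamel _ (continuousOn_modeLoad hf hh n (hu.mono hJ)
      (fun t ht => hux t (hJ ht)) (huxc.mono hJ)) fun t ht => heq t (hJ ht) (n + 1) (by omega)
  exact ⟨⟨ux, fun t ht => hux t (hJ ht), huxc.mono hJ⟩, hu.mono hJ, hv.mono hJ,
    fun t ht n => (hasDerivWithinAt_modeVec_iff.1 (key n t ht)).1,
    fun t ht n => (hasDerivWithinAt_modeVec_iff.1 (key n t ht)).2⟩

/-- A solution of the equations of the modes is a mild solution. -/
lemma SolvesModes.isMildSolution (hf : FoundationAssumption f) (hh : Continuous h)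
    {u v : ℝ → L2} (hs : SolvesModes p f ε h (Ici 0) u v) :
    IsMildSolution p f ε h (Ici 0) u v := by
  refine ⟨hs.exists_weakDeriv, hs.continuousOn_u, hs.continuousOn_v, fun t ht n hn => ?_⟩
  obtain ⟨n, rfl⟩ := Nat.exists_eq_add_of_le' hn
  have hs' := hs.mono (Icc_subset_Ici_self : Icc 0 t ⊆ Ici 0)
  obtain ⟨ux, hux, huxc⟩ := hs'.exists_weakDeriv
  exact duhamel_of_hasDerivWithinAt (modeMatrix p (n + 1)) (x := modeVec n u v)
    (G := modeLoad p f ε h n u) ht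
    (continuousOn_modeLoad hf hh n hs'.continuousOn_u hux huxc)
    fun s hs => hasDerivWithinAt_modeVec_iff.2 ⟨hs'.hasDeriv_u s hs n, hs'.hasDeriv_v s hs n⟩

/-! ### The global classical solution -/

lemma eq_of_uOp_eq_of_vOp_eq (hp : p.Admissible) {ζ ζ' : CSeq} (hu : hp.uOp ζ = hp.uOp ζ')
    (hv : hp.vOp ζ = hp.vOp ζ') : ζ = ζ' := by
  refine lp.ext (funext fun n => Complex.ext ?_ ?_)
  · have h1 := hp.pair_uOp ζ n
    rw [hu, hp.pair_uOp] at h1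
    exact ((div_left_inj' (hp.stiff_pos n).ne').1 h1).symm
  · have h1 := hp.pair_vOp ζ n
    rw [hv, hp.pair_vOp] at h1
    exact ((div_left_inj' (hp.inertia_pos n).ne').1 h1).symm

lemma IsModalSolution.mono {hp : p.Admissible} {J J' : Set ℝ} {F : ℝ → L2} {ζ : ℝ → CSeq}
    (hζ : IsModalSolution hp J F ζ) (hJ : J' ⊆ J) : IsModalSolution hp J' F ζ :=
  ⟨hζ.continuousOn.mono hJ, hζ.continuousOn_load.mono hJ,
    fun t ht n => (hζ.hasDeriv t (hJ ht) n).mono hJ⟩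

/-- The solutions on the intervals `[0, N]` fit together to a solution on `[0, ∞)`. -/
lemma exists_isModalSolution_Ici (hp : p.Admissible) (hf : FoundationAssumption f)
    (hh : Continuous h) (ε : ℝ) (ζ₀ : CSeq) :
    ∃ (F : ℝ → L2) (ζ : ℝ → CSeq), ζ 0 = ζ₀ ∧ IsModalSolution hp (Ici 0) F ζ ∧
      ∀ t ∈ Ici (0 : ℝ), F t =ᵐ[volume.restrict (Ioo (0 : ℝ) Real.pi)]
        load f ε (hp.uOp (ζ t)) (h t) := by
  choose F ζ hζ0 hζ hF using fun N : ℕ =>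
    exists_isModalSolution hp hf hh ε (Nat.cast_nonneg N) ζ₀
  have hζeq : ∀ N M : ℕ, ∀ t : ℝ, 0 ≤ t → t ≤ N → t ≤ M → ζ N t = ζ M t := by
    intro N M t ht htN htM
    have h1 := ((hζ N).solvesModes (hF N)).mono (Icc_subset_Icc_right htN)
    have h2 := ((hζ M).solvesModes (hF M)).mono (Icc_subset_Icc_right htM)
    obtain ⟨h3, h4⟩ := h1.unique hp hf h2 (by simp only [hζ0]) (by simp only [hζ0]) t ⟨ht, le_rfl⟩
    exact eq_of_uOp_eq_of_vOp_eq hp h3 h4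
  have hFeq : ∀ N M : ℕ, ∀ t : ℝ, 0 ≤ t → t ≤ N → t ≤ M → F N t = F M t := by
    intro N M t ht htN htM
    refine Lp.ext ((hF N t ⟨ht, htN⟩).trans ?_)
    rw [hζeq N M t ht htN htM]
    exact (hF M t ⟨ht, htM⟩).symm
  have hlt : ∀ t : ℝ, t < (⌊t⌋₊ + 1 : ℕ) := fun t => by exact_mod_cast Nat.lt_floor_add_one t
  have hnhds : ∀ t : ℝ, Icc 0 ((⌊t⌋₊ + 1 : ℕ) : ℝ) ∈ 𝓝[Ici 0] t := fun t => by
    rw [← Ici_inter_Iic]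
    exact inter_mem_nhdsWithin _ (Iic_mem_nhds (hlt t))
  have hζs : ∀ N : ℕ, ∀ s ∈ Icc (0 : ℝ) N, ζ (⌊s⌋₊ + 1) s = ζ N s := fun N s hs =>
    hζeq _ _ s hs.1 (hlt s).le hs.2
  have hFs : ∀ N : ℕ, ∀ s ∈ Icc (0 : ℝ) N, F (⌊s⌋₊ + 1) s = F N s := fun N s hs =>
    hFeq _ _ s hs.1 (hlt s).le hs.2
  refine ⟨fun t => F (⌊t⌋₊ + 1) t, fun t => ζ (⌊t⌋₊ + 1) t, hζ0 _, ⟨fun t ht => ?_, fun t ht => ?_,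
    fun t ht n => ?_⟩, fun t ht => hF _ t ⟨ht, (hlt t).le⟩⟩
  · have ht' : t ∈ Icc (0 : ℝ) (⌊t⌋₊ + 1 : ℕ) := ⟨ht, (hlt t).le⟩
    exact (((hζ _).continuousOn t ht').congr (hζs _) (hζs _ t ht')).mono_of_mem_nhdsWithin (hnhds t)
  · have ht' : t ∈ Icc (0 : ℝ) (⌊t⌋₊ + 1 : ℕ) := ⟨ht, (hlt t).le⟩
    exact (((hζ _).continuousOn_load t ht').congr (hFs _) (hFs _ t ht')).mono_of_mem_nhdsWithin
      (hnhds t)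
  · have ht' : t ∈ Icc (0 : ℝ) (⌊t⌋₊ + 1 : ℕ) := ⟨ht, (hlt t).le⟩
    exact (((hζ _).hasDeriv t ht' n).congr (fun s hs => by simp only [hζs _ s hs])
      rfl).mono_of_mem_nhdsWithin (hnhds t)

namespace BeamParams.Admissible

/-- The sine coefficients of the acceleration caused by the elastic forces. -/
def elasticSeq (hp : p.Admissible) : CSeq →L[ℝ] RSeq :=
  reMul (fun n => -(freq p n / inertia p n)) (√(p.α + p.γ) / p.μ) fun n => by
    rw [abs_neg, abs_of_nonneg (div_nonneg (hp.freq_nonneg n) (hp.inertia_pos n).le)]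
    exact hp.freq_div_inertia_le n

lemma elasticSeq_apply (hp : p.Admissible) (ζ : CSeq) (n : ℕ) :
    hp.elasticSeq ζ n = -(freq p n / inertia p n) * (ζ n).re := rfl

/-- The acceleration `u_tt` as a function of the load and the energy coordinates. -/
def accel (hp : p.Admissible) (F : L2) (ζ : CSeq) : L2 :=
  sinSeries (hp.elasticSeq ζ) + hp.vOp (hp.rhs F ζ)

lemma pair_accel (hp : p.Admissible) (F : L2) (ζ : CSeq) (n : ℕ) :
    pair (hp.accel F ζ) (sinMode n) = (-((p.α * waveNum n ^ 4 + p.γ) * pair (hp.uOp ζ) (sinMode n))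
        - (p.β * waveNum n ^ 2 + p.δ) * pair (hp.vOp ζ) (sinMode n)
        + pair F (sinMode n)) / (1 + p.μ * waveNum n ^ 2) := by
  rw [← sineCoord_apply, accel, map_add, sineCoord_apply, sineCoord_apply, pair_sinSeries,
    elasticSeq_apply, hp.pair_uOp, hp.pair_vOp, hp.pair_vOp, rhs, lp.coeFn_add, Pi.add_apply,
    hp.dampOp_apply, hp.loadOp_apply, ← add_mul, ← Complex.ofReal_add, Complex.im_ofReal_mul,
    Complex.I_im]
  have h1 := (hp.stiff_pos n).ne'
  have h2 := (hp.inertia_pos n).ne'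
  rw [freq, damp, ← hp.sq_stiff, ← hp.sq_inertia]
  field_simp
  ring

end BeamParams.Admissible

lemma hasSum_pair (w : L2) {φ : ℝ → ℝ} (hφ : Continuous φ) :
    HasSum (fun n => pair w (sinMode n) * pair φ (sinMode n)) (pair w φ) := by
  have h1 := hasSum_inner_sinSeries (sineBasis.repr w) (ofContinuous φ hφ)
  rw [sinSeries_repr, real_inner_comm, inner_ofContinuous] at h1
  refine h1.congr_fun fun n => ?_
  rw [sineBasis_repr_apply, pair_congr (coeFn_ofContinuous hφ)]

lemma contDiff_deriv {φ : ℝ → ℝ} (hφ : ContDiff ℝ ∞ φ) : ContDiff ℝ ∞ (deriv φ) :=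
  (contDiff_infty_iff_deriv.1 hφ).2

lemma pair_deriv_deriv_sinMode {φ : ℝ → ℝ} (hφ : ContDiff ℝ ∞ φ) (h0 : φ 0 = 0)
    (hπ : φ Real.pi = 0) (n : ℕ) :
    pair (deriv (deriv φ)) (sinMode n) = -(waveNum n ^ 2 * pair φ (sinMode n)) := by
  rw [pair_deriv_sinMode (contDiff_deriv hφ), pair_deriv_cosMode hφ h0 hπ]
  ring

/-- The equation of motion, tested with a smooth function vanishing at the ends, by Parseval's
identity. -/
lemma pair_accel_equation (hp : p.Admissible) (F : L2) (ζ : CSeq) {φ : ℝ → ℝ}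
    (hφ : ContDiff ℝ ∞ φ) (h0 : φ 0 = 0) (hπ : φ Real.pi = 0) :
    pair (hp.accel F ζ) φ - p.μ * pair (hp.accel F ζ) (deriv (deriv φ)) =
      - p.α * pair (hp.uxxOp ζ) (deriv (deriv φ)) - p.β * pair (hp.vxOp ζ) (deriv φ)
        - p.γ * pair (hp.uOp ζ) φ - p.δ * pair (hp.vOp ζ) φ + pair F φ := by
  have hd2 : Continuous (deriv (deriv φ)) := (contDiff_deriv (contDiff_deriv hφ)).continuous
  -- the damping term is moved onto the sines by the weak derivative, with the test function `φ'`
  have hv : pair (hp.vxOp ζ) (deriv φ) = -pair (hp.vOp ζ) (deriv (deriv φ)) := by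
    have := hp.isWeakDerivZero_vOp ζ (deriv φ) (contDiff_deriv hφ)
    linarith
  rw [hv]
  have hl := (hasSum_pair (hp.accel F ζ) hφ.continuous).sub
    ((hasSum_pair (hp.accel F ζ) hd2).mul_left p.μ)
  have hr := (((((hasSum_pair (hp.uxxOp ζ) hd2).mul_left (-p.α)).sub
    ((hasSum_pair (hp.vOp ζ) hd2).neg.mul_left p.β)).sub
    ((hasSum_pair (hp.uOp ζ) hφ.continuous).mul_left p.γ)).sub
    ((hasSum_pair (hp.vOp ζ) hφ.continuous).mul_left p.δ)).add (hasSum_pair F hφ.continuous)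
  refine hl.unique (hr.congr_fun fun n => ?_)
  have h1 : 0 < 1 + p.μ * waveNum n ^ 2 := by have := hp.μ_pos; positivity
  have h2 := hp.pair_accel F ζ n
  rw [eq_div_iff h1.ne'] at h2
  rw [pair_deriv_deriv_sinMode hφ h0 hπ, hp.pair_uxxOp, ← hp.pair_uOp]
  linear_combination pair φ (sinMode n) * h2

lemma IsModalSolution.isClassicalSolution {hp : p.Admissible} {F : ℝ → L2} {ζ : ℝ → CSeq}
    (hζ : IsModalSolution hp (Ici 0) F ζ)
    (hF : ∀ t ∈ Ici (0 : ℝ), F t =ᵐ[volume.restrict (Ioo (0 : ℝ) Real.pi)]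
        load f ε (hp.uOp (ζ t)) (h t)) :
    IsClassicalSolution p f ε h (Ici 0) (fun t => hp.uOp (ζ t)) (fun t => hp.vOp (ζ t)) := by
  have hc := hζ.continuousOn
  have hac : ContinuousOn (fun t => hp.accel (F t) (ζ t)) (Ici 0) :=
    (sinSeries.continuous.comp_continuousOn (hp.elasticSeq.continuous.comp_continuousOn hc)).add
      (hp.vOp.continuous.comp_continuousOn ((hp.dampOp.continuous.comp_continuousOn hc).add
        (hp.loadOp.continuous.comp_continuousOn hζ.continuousOn_load)))
  have hT : ∀ T : ℝ, Icc 0 T ⊆ Ici 0 := fun T => Icc_subset_Ici_self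
  refine ⟨fun t => hp.uxOp (ζ t), fun t => hp.uxxOp (ζ t), fun t => hp.vxOp (ζ t),
    fun t => hp.accel (F t) (ζ t), fun t _ => ⟨hp.isWeakDerivZero_uOp _, hp.isWeakDeriv_uxOp _,
      hp.isWeakDerivZero_vOp _⟩, fun t ht => ⟨?_, ?_⟩, hp.vOp.continuous.comp_continuousOn hc,
    hp.vxOp.continuous.comp_continuousOn hc, fun t ht => ?_, hac, fun t ht φ hφ h0 hπ => ?_⟩
  · exact HasDerivWithinAt.Ici_of_Icc (lt_add_one t)
      ((hζ.mono (hT _)).hasDerivWithinAt_uOp t ⟨ht, (lt_add_one t).le⟩)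
  -- The cosines are not complete, so the derivative of `u_x` is taken at the level of sequences.
  · have h1 := hasDerivWithinAt_of_coordinates (T := t + 1)
      (fun n => lp.evalCLM ℝ (fun _ : ℕ => ℝ) 2 n)
      (fun x hx => lp.ext (funext hx)) (w := fun s => hp.uxSeq (ζ s))
      (w' := fun s => hp.vxSeq (ζ s)) (hp.vxSeq.continuous.comp_continuousOn (hc.mono (hT _)))
      (fun n s hs => by
        change HasDerivWithinAt (fun r => hp.uxSeq (ζ r) n) (hp.vxSeq (ζ s) n) _ _
        simp_rw [hp.uxSeq_apply, hp.vxSeq_apply]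
        refine (((hζ.mono (hT _)).hasDerivWithinAt_re hs n).const_mul _).congr_deriv ?_
        have := (hp.stiff_pos n).ne'
        rw [freq]
        field_simp) t ⟨ht, (lt_add_one t).le⟩
    exact cosSeries.toContinuousLinearMap.hasFDerivAt.comp_hasDerivWithinAt t
      (HasDerivWithinAt.Ici_of_Icc (lt_add_one t) h1)
  · refine HasDerivWithinAt.Ici_of_Icc (lt_add_one t) (hasDerivWithinAt_of_coordinates sineCoord
      eq_zero_of_sineCoord_eq_zero (w' := fun t => hp.accel (F t) (ζ t)) (hac.mono (hT _))
      (fun n s hs => ?_) t ⟨ht, (lt_add_one t).le⟩)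
    simp_rw [sineCoord_apply, hp.pair_accel]
    exact (hζ.mono (hT _)).hasDerivWithinAt_pair_vOp hs n
  · rw [← pair_congr (hF t ht)]
    exact pair_accel_equation hp (F t) (ζ t) hφ h0 hπ

end

end RayleighBeam

theorem proposition6p4 (p : RayleighBeam.BeamParams)
    (hα : 0 < p.α) (hβ : 0 ≤ p.β) (hγ : 0 ≤ p.γ) (hδ : 0 ≤ p.δ) (hμ : 0 < p.μ)
    (f : ℝ → ℝ) (hf : RayleighBeam.FoundationAssumption f)
    (τ : ℝ) (h : ℝ → RayleighBeam.L2) (hh : RayleighBeam.ForcingAssumption τ h)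
    (ε : ℝ) (u₀ v₀ : RayleighBeam.L2) (h₀ : RayleighBeam.MemDomain u₀ v₀) :
    ∃ u v : ℝ → RayleighBeam.L2,
      u 0 = u₀ ∧ v 0 = v₀ ∧
      RayleighBeam.IsClassicalSolution p f ε h (Set.Ici 0) u v ∧
      RayleighBeam.IsMildSolution p f ε h (Set.Ici 0) u v ∧
      ∀ (T : ℝ) (u' v' : ℝ → RayleighBeam.L2),
        (RayleighBeam.IsClassicalSolution p f ε h (Set.Ico 0 T) u' v' ∨
          RayleighBeam.IsMildSolution p f ε h (Set.Ico 0 T) u' v') →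
        u' 0 = u₀ → v' 0 = v₀ →
        ∀ t ∈ Set.Ico 0 T, u' t = u t ∧ v' t = v t := by
  have hp : p.Admissible := ⟨hα, hβ, hγ, hδ, hμ⟩
  have hhc : Continuous h := hh.contDiff.continuous
  obtain ⟨ζ₀, hu₀, hv₀⟩ := hp.exists_energy_coordinates h₀
  obtain ⟨F, ζ, hζ0, hζ, hF⟩ := RayleighBeam.exists_isModalSolution_Ici hp hf hhc ε ζ₀
  have hmodes := hζ.solvesModes hF
  refine ⟨fun t => hp.uOp (ζ t), fun t => hp.vOp (ζ t), by simp only [hζ0, hu₀],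
    by simp only [hζ0, hv₀], hζ.isClassicalSolution hF, hmodes.isMildSolution hf hhc, ?_⟩
  intro T u' v' hs hu' hv' t ht
  have hJ : Set.Icc 0 t ⊆ Set.Ico 0 T := fun s hs => ⟨hs.1, hs.2.trans_lt ht.2⟩
  have hmodes' : RayleighBeam.SolvesModes p f ε h (Set.Icc 0 t) u' v' :=
    hs.elim (fun hs => (hs.solvesModes hp).mono hJ) fun hs => hs.solvesModes hf hhc hJ
  exact hmodes'.unique hp hf (hmodes.mono Set.Icc_subset_Ici_self) (by simp only [hu', hζ0, hu₀])
    (by simp only [hv', hζ0, hv₀]) t ⟨ht.1, le_rfl⟩
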